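/- **Setting.** Let $p$ be a prime, $\mathbb{G}$ a group of order $p$ and $g,g_0,g_1,\dots,h\in\mathbb{G}\setminus\{1\}$. Write $\mathsf{comm}(m_0,\dots,m_{n-1};r)=\prod_i g_i^{m_i}\cdot h^r$ (generalized Pedersen commitment; $\mathsf{comm}(m)$ means that $r\in\mathbb{Z}_p$ is fresh and uniform) and $F_k(x)=g^{1/(1+k+x)}$ for $k,x\in\mathbb{Z}_p$ (Dodis–Yampolskiy function; the exponent is read as $0$ if $1+k+x=0$). Let $\mathsf{bsgn}$ be the RSA full-domain-hash blind signature scheme, $\mathsf{zsgn}$ a correct signature scheme whose signer signs commitments, $\mathsf{sgn}$ a correct digital signature scheme, and $\Pi$ a complete non-interactive proof system in the random oracle model, with a simulator, for the three relations below. Let $H$ be a hash function from $\mathbb{G}$ to $\mathbb{Z}_p\setminus\{0\}$, $H'$ (from triples in $\mathbb{G}$ to $\{0,1\}^\lambda$) and $H''$ (to $\mathbb{Z}_p$) further hash functions, and $\mathsf{RO}$ a random oracle with values in $\{0,1\}^\lambda$. **The (non-compact) scheme.** *Keys.* The bank has an RSA key pair for $\mathsf{bsgn}$, two $\mathsf{zsgn}$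 key pairs (for users and for ATMs) and an $\mathsf{sgn}$ key pair. ATM $j$ has $sk_j\in\mathbb{Z}_p$ uniform, $pk_j=g^{sk_j}$, a $\mathsf{zsgn}$-signature of the bank on $sk_j$, and an $\mathsf{sgn}$ key pair. User $i$ has $usk_i,\kappa_i\in\mathbb{Z}_p$ uniform, $upk_i=g^{usk_i}$, a $\mathsf{zsgn}$-signature of the bank on $(usk_i,\kappa_i)$, and an $\mathsf{sgn}$ key pair. *ReqCoin.* ATM $j$ picks $k_1,k_2\in\mathbb{Z}_p$ uniformly, sets $K_1=\mathsf{comm}(k_1)$, $K_2=\mathsf{comm}(k_2)$, $Q=\mathsf{comm}(sk_j)$, and obtains the bank's blind signature $\sigma$ on $H'(K_1,K_2,Q)$. The coin is $C=(K_1,K_2,Q,\sigma)$; it is put into the ATM's key store with the keys and openings. *Withdraw.* User $i$ sends $upk_i$, $P=\mathsf{comm}(usk_i,\kappa_i)$ and a proof $\pi$ that it knows an opening of $P$ and the bank's signature on it. *IssueVoucher.* If $\pi$ is valid and the user's balance is at least $1$, the ATM takes the next coin from its store, sets $r_c=H(P)$, $\mathsf{id}=r_c+1$, $X=F_{k_1}(\mathsf{id})$,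 $Y=pk_j\cdot F_{k_2}(0)^{r_c}$, computes a proof $\pi_{ATM}$ of knowledge of an opening of $Q$ and of the bank's signature on it and a proof $\pi_C$ that $X$ and $Y$ are computed in this way from the values committed in $K_1,K_2,Q$, and forms the voucher $V=(P,\pi,X,Y,\pi_C,\pi_{ATM},r_c)$. It sends the user a signed promise for $\mathsf{RO}(C,upk_i,pk_j)$, $V$ and a nonce; the user answers with a signed receipt on the nonce, whereupon the ATM sends $C$ and has the user's balance decreased by $1$. If the coin does not arrive or does not match the promise, the user complains to the bank. *SpendCoin.* The user sends the merchant $m$, who chose $r_v$, the values $C$, $V$, $Z=upk_i\cdot F_{\kappa_i}(\mathsf{id})^{r_t}$ with $r_t=H''(upk_m,r_v)$, and a proof that $Z$ is computed in this way from the values committed in $P$. *Deposit.* The bank checks all proofs, hash values and the coin signature, consults the complaints and the log of deposited coins, identifies a double-spending user or a double-issuing ATM from two tokens $Z$ or $Y$ with different exponents, and otherwise credits the merchant. **Experiment $b\in\{0,1\}$.** The bank, the ATMs and the users (some ATMs and users are honest) are initialized, and every honest ATM withdraws $s$ coins. The adversary $(\mathcal{A}_1,\mathcal{A}_2)$ gets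 all public keys, all secrets of the dishonest ATMs and users, and the transcripts (blinded message, answer of the bank) of the coin withdrawals. It may query the random oracles, the honest ATMs (withdraw further coins, with transcript and at most a fixed number of coins per query; issue a voucher; accept a receipt), the honest users (withdraw, accept promises and coins, spend, act as merchant), and the bank (blind signing, debiting, complaints, deposits). $\mathcal{A}_1$ chooses two ATMs $j_0,j_1$ and a user $i$. If $j_0\neq j_1$ are honest ATMs and $i$ is an honest user, then $i$ runs Withdraw with IssueVoucher of ATM $j_b$; the resulting $(C,V)$ is given to $\mathcal{A}_2$ and put into $i$'s wallet (the promise is not shown, and no receipt is issued). $\mathcal{A}_2$, which shares the memory of $\mathcal{A}_1$ and keeps the oracle access, outputs a bit, which is the result of the experiment. The result is $0$ if the choice is inadmissible or the withdrawal aborts. Let $$\mathrm{Adv}_{\mathrm{untrace}}(t,q)=\sup_{\mathcal{A}_1,\mathcal{A}_2}\big(\Pr[\text{result}=1\mid b=1]-\Pr[\text{result}=1\mid b=0]\big)$$ over adversaries of total running time at most $t$ with at most $q$ oracle queries. **Other advantages** (suprema of absolute differences of the probabilities of output $1$, over adversaries of running time at most $t$ with at most $q$ oracle queries). $\mathrm{Adv}_{\mathrm{hiding}}$: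 left-or-right commitment oracle for $\mathsf{comm}$. $\mathrm{Adv}_{\mathrm{PRF}}$: $F_k$ with uniform $k$ against a uniformly random function $\mathbb{Z}_p\to\mathbb{G}$. $\mathrm{Adv}_{\mathrm{blind}}$: left-or-right blinding oracle of $\mathsf{bsgn}$, the adversary knowing the RSA key pair. $\mathrm{Adv}_{\mathrm{ZK}}$: random oracle and honest proofs, for adaptively chosen statement–witness pairs in the relation, against the simulator of $\Pi$ (hash values and proofs both count as queries). Running time is measured in any fixed machine model that prices the elementary instructions, an oracle call having price $1$. Let $\tau$ and $n$ be such that each of the following is carried out in time at most $\tau$ with at most $n$ random oracle evaluations and proofs: the initialization, the answer to one oracle query, the challenge for each $b$, and the computation of the result. **Theorem.** The IssueVoucher procedure of this scheme gives untraceability: if $q<s$, then $$\mathrm{Adv}_{\mathrm{untrace}}(t,q)\le 6\,\mathrm{Adv}_{\mathrm{hiding}}(t,q)+4\,\mathrm{Adv}_{\mathrm{PRF}}(t,q)+4\,\mathrm{Adv}_{\mathrm{ZK}}\big(t+(q+3)\tau,\;(q+3)n\big)+2\,\mathrm{Adv}_{\mathrm{blind}}(t,q).$$ -/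

import Mathlib

open scoped Classical ENNReal

noncomputable section

namespace ECash

/-! ## Algorithms with oracle access and their running time -/

/-- Probabilistic oracle algorithms with input in `α` and output in `β`, as straight-line programs.
`step f` is one local (probabilistic) instruction, `call` is one oracle gate (which stays idle on
`none`), `seq` is sequential composition, `frame γ P` runs `P` while the rest `γ` of the memory is
left untouched, and `swap` only renames memory cells. -/
inductive Prog (Q R : Type) : Type → Type → Type 1
  | step {α β : Type} (f : α → PMF β) : Prog Q R α β
  | call : Prog Q R (Option Q) (Option R)
  | seq {α β γ : Type} (P : Prog Q R α β) (P' : Prog Q R β γ) : Prog Q R α γ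
  | frame {α β : Type} (γ : Type) (P : Prog Q R α β) : Prog Q R (α × γ) (β × γ)
  | swap (α β γ : Type) : Prog Q R ((α × β) × γ) ((α × γ) × β)

/-- A machine model: the price of every local instruction (`⊤` if the machine does not have it). -/
def CostModel : Type 1 := ∀ α β : Type, (α → PMF β) → ℕ∞

/-- The running time of an algorithm: the total price of its instructions, an oracle gate having
price `1`. -/
def Prog.cost {Q R : Type} (c : CostModel) : {α β : Type} → Prog Q R α β → ℕ∞
  | _, _, .step f => c _ _ f
  | _, _, .call => 1
  | _, _, .seq P P' => P.cost c + P'.cost c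
  | _, _, .frame _ P => P.cost c
  | _, _, .swap _ _ _ => 0

/-- The number of oracle queries of an algorithm (the number of its oracle gates). -/
def Prog.calls {Q R : Type} : {α β : Type} → Prog Q R α β → ℕ
  | _, _, .step _ => 0
  | _, _, .call => 1
  | _, _, .seq P P' => P.calls + P'.calls
  | _, _, .frame _ P => P.calls
  | _, _, .swap _ _ _ => 0

/-- Execution of an algorithm, its queries being answered by `O`. -/
def Prog.eval {Q R : Type} {m : Type → Type} [Monad m] [MonadLiftT PMF m] (O : Q → m R) :
    {α β : Type} → Prog Q R α β → α → m β
  | _, _, .step f, a => liftM (f a)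
  | _, _, .call, none => pure none
  | _, _, .call, some x => do
      let r ← O x
      pure (some r)
  | _, _, .seq P P', a => do
      let b ← P.eval O a
      P'.eval O b
  | _, _, .frame _ P, (a, z) => do
      let b ← P.eval O a
      pure (b, z)
  | _, _, .swap _ _ _, ((a, b), z) => pure ((a, z), b)

/-- The probability that an experiment returns `1`. -/
def prob (e : PMF Bool) : ℝ := (e true).toReal

/-- `n` independent samples. -/
def sampleFin {α : Type} (d : PMF α) : (n : ℕ) → PMF (Fin n → α)
  | 0 => pure Fin.elim0
  | n + 1 => do
      let a ← d
      let f ← sampleFin d n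
      pure (Fin.cons a f)

/-- `n` independent samples, as a list. -/
def sampleList {α : Type} (d : PMF α) : ℕ → PMF (List α)
  | 0 => pure []
  | n + 1 => do
      let a ← d
      let l ← sampleList d n
      pure (a :: l)

abbrev Bits (n : ℕ) : Type := Fin n → Bool

/-- A random oracle, sampled lazily; the state is the table of the values fixed so far. -/
def lazyRO (X Y : Type) [Fintype Y] [Nonempty Y] (x : X) : StateT (X → Option Y) PMF Y := do
  let tbl ← get
  match tbl x with
  | some y => pure y
  | none => do
      let y ← (PMF.uniformOfFintype Y : PMF Y)
      set (Function.update tbl x (some y))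
      pure y

/-! ## Group, commitments, pseudorandom function -/

/-- Public parameters: a group of prime order `p`, a generator `g`, and the generators
`base 0, base 1, …` and `h` used by the commitment scheme. -/
structure GroupParams (p : ℕ) (G : Type) [CommGroup G] [Fintype G] where
  card_eq : Fintype.card G = p
  g : G
  base : ℕ → G
  h : G
  g_ne : g ≠ 1
  base_ne : ∀ i, base i ≠ 1
  h_ne : h ≠ 1

/-- `x ^ a` for an exponent modulo the group order. -/
def gpow {p : ℕ} {G : Type} [CommGroup G] (x : G) (a : ZMod p) : G := x ^ a.val

section Group

variable {p : ℕ} [Fact p.Prime] {G : Type} [CommGroup G] [Fintype G]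

/-- Uniform sampling from `ℤ/p`. -/
def unifZ (p : ℕ) [Fact p.Prime] : PMF (ZMod p) := PMF.uniformOfFintype (ZMod p)

/-- The generalized Pedersen commitment to the messages `m` with random coin `r`. -/
def GroupParams.comm (pp : GroupParams p G) {n : ℕ} (m : Fin n → ZMod p) (r : ZMod p) : G :=
  (∏ i : Fin n, gpow (pp.base i.val) (m i)) * gpow pp.h r

/-- The Dodis-Yampolskiy function `F_k(x) = g ^ (1 / (1 + k + x))`; the exponent is read as `0`
when `1 + k + x = 0`. -/
def GroupParams.prf (pp : GroupParams p G) (k x : ZMod p) : G := gpow pp.g (1 + k + x)⁻¹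

/-- The left-or-right commitment oracle: on two message vectors of the same length it commits to
the one selected by `b`, with fresh randomness. -/
def GroupParams.hidingOracle (pp : GroupParams p G) (b : Bool)
    (m : Σ n : ℕ, (Fin n → ZMod p) × (Fin n → ZMod p)) : PMF G := do
  let r ← unifZ p
  pure (pp.comm (if b then m.2.2 else m.2.1) r)

/-- The hiding advantage of the commitment scheme for time `t` and `q` queries. -/
def GroupParams.hidingAdv (pp : GroupParams p G) (c : CostModel) (t : ℕ∞) (q : ℕ) : ℝ :=
  ⨆ A : {A : Prog (Σ n : ℕ, (Fin n → ZMod p) × (Fin n → ZMod p)) G Unit Bool //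
      A.cost c ≤ t ∧ A.calls ≤ q},
    |prob (A.1.eval (pp.hidingOracle false) ()) - prob (A.1.eval (pp.hidingOracle true) ())|

/-- The PRF advantage for time `t` and `q` queries: the function `F_k` under a uniform key against
a uniformly random function. -/
def GroupParams.prfAdv (pp : GroupParams p G) (c : CostModel) (t : ℕ∞) (q : ℕ) : ℝ :=
  ⨆ A : {A : Prog (ZMod p) G Unit Bool // A.cost c ≤ t ∧ A.calls ≤ q},
    |prob (do
        let k ← unifZ p
        A.1.eval (m := PMF) (fun x => pure (pp.prf k x)) ()) -
      prob (do
        let f ← (PMF.uniformOfFintype (ZMod p → G) : PMF (ZMod p → G))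
        A.1.eval (m := PMF) (fun x => pure (f x)) ())|

end Group

/-! ## Signatures -/

/-- A digital signature scheme for messages in `Msg`. -/
structure SigScheme (Msg : Type) where
  VK : Type
  SK : Type
  Sig : Type
  keygen : PMF (VK × SK)
  sign : SK → Msg → PMF Sig
  verify : VK → Msg → Sig → Bool
  correct : ∀ k ∈ keygen.support, ∀ m, ∀ σ ∈ (sign k.2 m).support, verify k.1 m σ = true

/-- An RSA key pair with modulus `P * Q`, public exponent `e` and private exponent `d`. -/
structure RSAKey where
  P : ℕ
  Q : ℕ
  e : ℕ
  d : ℕ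
  hP : P.Prime
  hQ : Q.Prime
  ne : P ≠ Q
  hed : e * d ≡ 1 [MOD Nat.totient (P * Q)]

def RSAKey.N (K : RSAKey) : ℕ := K.P * K.Q

instance (K : RSAKey) : NeZero K.N := ⟨Nat.mul_ne_zero K.hP.ne_zero K.hQ.ne_zero⟩

/-- The RSA blind signature scheme for messages in `Msg`: a key generator and a full-domain hash. -/
structure RSABlind (Msg : Type) where
  keygen : PMF RSAKey
  fdh : (N : ℕ) → Msg → (ZMod N)ˣ

namespace RSABlind

variable {Msg : Type} (B : RSABlind Msg)

/-- The blinded message `H(m) * r ^ e mod N`. -/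
def blind (K : RSAKey) (m : Msg) (r : (ZMod K.N)ˣ) : ℕ :=
  ((B.fdh K.N m * r ^ K.e : (ZMod K.N)ˣ) : ZMod K.N).val

/-- Signing a blinded message. -/
def sign (K : RSAKey) (x : ℕ) : ℕ := ((x : ZMod K.N) ^ K.d).val

/-- Removing the blinding factor from a signature. -/
def unblind (K : RSAKey) (s : ℕ) (r : (ZMod K.N)ˣ) : ℕ :=
  ((s : ZMod K.N) * ((r⁻¹ : (ZMod K.N)ˣ) : ZMod K.N)).val

/-- Verification with the public key `(N, e)`. -/
def verify (N e : ℕ) (m : Msg) (s : ℕ) : Bool :=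
  decide ((s : ZMod N) ^ e = ((B.fdh N m : (ZMod N)ˣ) : ZMod N))

/-- The left-or-right blinding oracle. -/
def blindOracle (K : RSAKey) (b : Bool) (m : Msg × Msg) : PMF ℕ := do
  let r ← (PMF.uniformOfFintype (ZMod K.N)ˣ : PMF (ZMod K.N)ˣ)
  pure (B.blind K (if b then m.2 else m.1) r)

/-- The blinding experiment; the adversary plays the signer and holds the key pair. -/
def blindExp (b : Bool) (A : Prog (Msg × Msg) ℕ RSAKey Bool) : PMF Bool := do
  let K ← B.keygen
  A.eval (B.blindOracle K b) K

/-- The blinding advantage for time `t` and `q` queries. -/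
def blindAdv (c : CostModel) (t : ℕ∞) (q : ℕ) : ℝ :=
  ⨆ A : {A : Prog (Msg × Msg) ℕ RSAKey Bool // A.cost c ≤ t ∧ A.calls ≤ q},
    |prob (B.blindExp false A.1) - prob (B.blindExp true A.1)|

end RSABlind

/-- A signature scheme on committed values. The signer signs a commitment; the result is a
signature on the opening of the commitment. `valid pk m r σ` says that `σ` is a valid signature
on `m` under `pk` for its holder, who issued the signing request with commitment randomness `r`. -/
structure CommitSig {p : ℕ} [Fact p.Prime] {G : Type} [CommGroup G] [Fintype G]
    (pp : GroupParams p G) where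
  PK : Type
  SK : Type
  Sig : Type
  keygen : PMF (PK × SK)
  sign : SK → G → PMF Sig
  valid : PK → {n : ℕ} → (Fin n → ZMod p) → ZMod p → Sig → Prop
  correct : ∀ k ∈ keygen.support, ∀ (n : ℕ) (m : Fin n → ZMod p) (r : ZMod p),
    ∀ σ ∈ (sign k.2 (pp.comm m r)).support, valid k.1 m r σ

/-! ## Non-interactive zero-knowledge proofs -/

/-- The statements proved in the protocol. -/
inductive Stmt (p : ℕ) (G PK : Type)
  /-- knowledge of an opening of `com` and of a signature on it under `pk` -/
  | cert (pk : PK) (com : G)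
  /-- the tokens `X`, `Y` are computed from the values committed in `K₁`, `K₂`, `Q` -/
  | coin (K₁ K₂ X Y Q : G) (id rc : ZMod p)
  /-- the token `Z` is computed from the values committed in `P` -/
  | tx (P Z : G) (id rt : ZMod p)

/-- The witnesses. -/
inductive Wit (p : ℕ) (Sig : Type)
  | cert {n : ℕ} (m : Fin n → ZMod p) (r r₀ : ZMod p) (σ : Sig)
  | coin (α₁ β₁ α₂ β₂ γ δ : ZMod p)
  | tx (α β γ : ZMod p)

/-- The witness relation. -/
def Rel {p : ℕ} [Fact p.Prime] {G : Type} [CommGroup G] [Fintype G] (pp : GroupParams p G)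
    (Z : CommitSig pp) : Stmt p G Z.PK → Wit p Z.Sig → Prop
  | .cert pk com, .cert m r r₀ σ => com = pp.comm m r ∧ Z.valid pk m r₀ σ
  | .coin K₁ K₂ X Y Q id rc, .coin α₁ β₁ α₂ β₂ γ δ =>
      K₁ = pp.comm ![α₁] β₁ ∧ K₂ = pp.comm ![α₂] β₂ ∧ Q = pp.comm ![γ] δ ∧
        X = pp.prf α₁ id ∧ Y = gpow pp.g γ * gpow (pp.prf α₂ 0) rc
  | .tx P Z id rt, .tx α β γ =>
      P = pp.comm ![α, γ] β ∧ Z = gpow pp.g α * gpow (pp.prf γ id) rt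
  | _, _ => False

/-- A non-interactive zero-knowledge proof system for `R` in the random oracle model. The
simulator keeps a state, shared by its two interfaces `simHash` (simulated random oracle) and
`simGo` (simulated proofs, computed without a witness). -/
structure NIZK (lam : ℕ) {S W : Type} (R : S → W → Prop) where
  Proof : Type
  prove : Prog (List Bool) (Bits lam) (S × W) Proof
  verify : Prog (List Bool) (Bits lam) (S × Proof) Bool
  complete : ∀ x w, R x w → ∀ tbl : List Bool → Option (Bits lam),
    ∀ z ∈ ((do
        let π ← prove.eval (lazyRO (List Bool) (Bits lam)) (x, w)
        verify.eval (lazyRO (List Bool) (Bits lam)) (x, π) :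
          StateT (List Bool → Option (Bits lam)) PMF Bool).run tbl).support, z.1 = true
  Sim : Type
  simInit : PMF Sim
  simHash : List Bool → StateT Sim PMF (Bits lam)
  simGo : S → StateT Sim PMF Proof

/-- A random oracle together with a prover, the two services whose real and simulated versions
are compared in the definition of zero knowledge. -/
structure Service (lam : ℕ) (S W Proof : Type) (σ : Type) where
  hash : List Bool → StateT σ PMF (Bits lam)
  prove : S → W → StateT σ PMF (Option Proof)

/-- A service seen as one oracle. -/
def Service.oracle {lam : ℕ} {S W Proof σ : Type} (V : Service lam S W Proof σ) :
    List Bool ⊕ S × W → StateT σ PMF (Bits lam ⊕ Option Proof)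
  | .inl x => do
      let y ← V.hash x
      pure (.inl y)
  | .inr (x, w) => do
      let π ← V.prove x w
      pure (.inr π)

namespace NIZK

variable {lam : ℕ} {S W : Type} {R : S → W → Prop} (N : NIZK lam R)

/-- The random oracle and the honest prover, which is defined on instances of the relation. -/
def real : Service lam S W N.Proof (List Bool → Option (Bits lam)) where
  hash := lazyRO (List Bool) (Bits lam)
  prove x w := if R x w then do
      let π ← N.prove.eval (lazyRO (List Bool) (Bits lam)) (x, w)
      pure (some π)
    else pure none

/-- The simulator. -/
def simulated : Service lam S W N.Proof N.Sim where
  hash := N.simHash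
  prove x w := if R x w then do
      let π ← N.simGo x
      pure (some π)
    else pure none

abbrev Distinguisher : Type 1 :=
  Prog (List Bool ⊕ S × W) (Bits lam ⊕ Option N.Proof) Unit Bool

def zkReal (D : N.Distinguisher) : PMF Bool :=
  (D.eval N.real.oracle ()).run' (fun _ => none)

def zkSim (D : N.Distinguisher) : PMF Bool := do
  let s ← N.simInit
  (D.eval N.simulated.oracle ()).run' s

/-- The zero-knowledge advantage for time `t` and `q` queries: distinguishing the random oracle and
real proofs, for adaptively chosen instances of the relation, from the simulator. -/
def zkAdv (c : CostModel) (t : ℕ∞) (q : ℕ) : ℝ :=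
  ⨆ D : {D : N.Distinguisher // D.cost c ≤ t ∧ D.calls ≤ q},
    |prob (N.zkSim D.1) - prob (N.zkReal D.1)|

end NIZK

/-! ## The e-cash scheme -/

/-- A coin: commitments to two PRF keys and to the private key of the withdrawing ATM, with the
signature of the bank. -/
structure Coin (G : Type) where
  K₁ : G
  K₂ : G
  Q : G
  sig : ℕ

structure Voucher (p : ℕ) (G Proof : Type) where
  P : G
  πUser : Proof
  X : G
  Y : G
  πCoin : Proof
  πATM : Proof
  rc : ZMod p

structure Tx (p : ℕ) (G Proof : Type) (lam : ℕ) where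
  Z : G
  πTx : Proof
  rv : Bits lam
  rt : ZMod p

/-- The messages signed with the digital signature scheme: the promise of an ATM and the receipt
of a user. -/
inductive SignedMsg (p : ℕ) (G Proof : Type) (lam : ℕ)
  | promise (tag : Bits lam) (V : Voucher p G Proof) (nonce : Bits lam)
  | withdrawal (pkUser pkATM : G) (nonce : Bits lam)

/-- The ingredients of the non-compact scheme, with security parameter `lam`: group parameters, the
blind signature scheme with proofs of knowledge, the proof system, the RSA blind signature scheme,
the digital signature scheme and the hash functions. -/
structure Scheme (p : ℕ) [Fact p.Prime] (G : Type) [CommGroup G] [Fintype G] (lam : ℕ) where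
  grp : GroupParams p G
  zsgn : CommitSig grp
  nizk : NIZK lam (Rel grp zsgn)
  bsgn : RSABlind (Bits lam)
  sgn : SigScheme (SignedMsg p G nizk.Proof lam)
  hashCom : G → ZMod p
  hashCoin : G → G → G → Bits lam
  hashTx : G → Bits lam → ZMod p

/-- The parameters of the experiment: numbers of ATMs and users (the honest ones come first), the
number of coins that each honest ATM withdraws at the start, the maximal number of coins in one later
request, and the initial balances. -/
structure Setting where
  numATM : ℕ
  honestATM : ℕ
  numUser : ℕ
  honestUser : ℕ
  stock : ℕ
  batch : ℕ
  balance : Fin numUser → ℕ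

/-- The answers of the bank to a deposit. -/
inductive Outcome (G : Type)
  | abort
  | accepted
  | user (pk : G)
  | atm (pk : G)

namespace Scheme

variable {p : ℕ} [Fact p.Prime] {G : Type} [CommGroup G] [Fintype G] {lam : ℕ}
variable (S : Scheme p G lam) (E : Setting)

abbrev Proof : Type := S.nizk.Proof

abbrev Svc (σ : Type) : Type :=
  Service lam (Stmt p G S.zsgn.PK) (Wit p S.zsgn.Sig) S.Proof σ

/-! ### Keys -/

structure Bank where
  rsa : RSAKey
  zUser : S.zsgn.PK × S.zsgn.SK
  zATM : S.zsgn.PK × S.zsgn.SK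
  sig : S.sgn.VK × S.sgn.SK

/-- The secrets of an ATM: its private identity key, the signature of the bank on it (with the
randomness of the signed commitment), and its signing key pair. -/
structure ATM where
  sk : ZMod p
  cert : S.zsgn.Sig
  certRand : ZMod p
  vk : S.sgn.VK
  sgk : S.sgn.SK

/-- The secrets of a user: its private identity key, its spending key, the signature of the bank on
the two, and its signing key pair. -/
structure User where
  sk : ZMod p
  prfKey : ZMod p
  cert : S.zsgn.Sig
  certRand : ZMod p
  vk : S.sgn.VK
  sgk : S.sgn.SK

variable {S} in
def ATM.pk (a : S.ATM) : G := gpow S.grp.g a.sk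

variable {S} in
def User.pk (u : S.User) : G := gpow S.grp.g u.sk

structure Keys where
  bank : S.Bank
  atm : Fin E.numATM → S.ATM
  user : Fin E.numUser → S.User

def initBank : PMF S.Bank := do
  let sig ← S.sgn.keygen
  let rsa ← S.bsgn.keygen
  let zU ← S.zsgn.keygen
  let zA ← S.zsgn.keygen
  pure ⟨rsa, zU, zA, sig⟩

def initATM (B : S.Bank) : PMF S.ATM := do
  let sk ← unifZ p
  let r ← unifZ p
  let σ ← S.zsgn.sign B.zATM.2 (S.grp.comm ![sk] r)
  let k ← S.sgn.keygen
  pure ⟨sk, σ, r, k.1, k.2⟩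

def initUser (B : S.Bank) : PMF S.User := do
  let sk ← unifZ p
  let k ← unifZ p
  let r ← unifZ p
  let σ ← S.zsgn.sign B.zUser.2 (S.grp.comm ![sk, k] r)
  let s ← S.sgn.keygen
  pure ⟨sk, k, σ, r, s.1, s.2⟩

/-! ### Withdrawal of coins by an ATM -/

/-- A coin in the key store of an ATM, with the PRF keys and the openings of the commitments. -/
structure StoredCoin (p : ℕ) (G : Type) where
  coin : Coin G
  k₁ : ZMod p
  r₁ : ZMod p
  k₂ : ZMod p
  r₂ : ZMod p
  rQ : ZMod p

/-- The withdrawal of one coin by an ATM. The second component is the transcript: the blinded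
message and the answer of the bank. -/
def reqCoin (B : S.Bank) (a : S.ATM) : PMF (StoredCoin p G × (ℕ × ℕ)) := do
  let k₁ ← unifZ p
  let k₂ ← unifZ p
  let r₁ ← unifZ p
  let r₂ ← unifZ p
  let rQ ← unifZ p
  let K₁ := S.grp.comm ![k₁] r₁
  let K₂ := S.grp.comm ![k₂] r₂
  let Q := S.grp.comm ![a.sk] rQ
  let r ← (PMF.uniformOfFintype (ZMod B.rsa.N)ˣ : PMF (ZMod B.rsa.N)ˣ)
  let K := S.bsgn.blind B.rsa (S.hashCoin K₁ K₂ Q) r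
  let s := RSABlind.sign B.rsa K
  let σ := RSABlind.unblind B.rsa s r
  pure (⟨⟨K₁, K₂, Q, σ⟩, k₁, r₁, k₂, r₂, rQ⟩, (K, s))

/-! ### State of the honest parties -/

structure Promise where
  sig : S.sgn.Sig
  tag : Bits lam
  V : Voucher p G S.Proof
  nonce : Bits lam

/-- A withdrawal at an honest ATM that waits for its receipt. -/
structure ATMSession where
  user : Fin E.numUser
  nonce : Bits lam
  coin : Coin G

/-- A withdrawal by an honest user: the opening of the commitment, and the promise received. -/
structure UserSession where
  rand : ZMod p
  promise : Option (Fin E.numATM × S.Promise)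

/-- A complaint of a user about an aborted withdrawal. -/
structure Complaint where
  user : Fin E.numUser
  atm : Fin E.numATM
  promise : S.Promise

/-- A deposited coin. -/
structure LogEntry (p : ℕ) (G : Type) where
  C : Coin G
  id : ZMod p
  Y : G
  Z : G
  rc : ZMod p
  rt : ZMod p

/-- The mutable state of the parties, apart from the key stores of the ATMs. -/
structure Dyn where
  ro : Coin G × G × G → Option (Bits lam)
  atmSession : Fin E.numATM → List (ATMSession (lam := lam) (G := G) E)
  userSession : Fin E.numUser → List (S.UserSession E)
  wallet : Fin E.numUser → List (Coin G × Voucher p G S.Proof × ZMod p)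
  merchant : Fin E.numUser → List (Bits lam)
  balance : Fin E.numUser → ℕ
  settled : List (Fin E.numUser × Fin E.numATM × Bits lam)
  log : List (LogEntry p G)
  invalid : List (S.Complaint E)

structure Sys where
  keys : S.Keys E
  store : Fin E.numATM → List (StoredCoin p G)
  dyn : S.Dyn E
  aborted : Bool

/-- Actions on the mutable state, with access to the random oracle and the prover. -/
abbrev Act (σ : Type) : Type → Type := StateT (S.Dyn E) (StateT σ PMF)

variable {S E} {σ : Type} (V : S.Svc σ) (k : S.Keys E)

def verifyProof (x : Stmt p G S.zsgn.PK) (π : S.Proof) : StateT σ PMF Bool :=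
  S.nizk.verify.eval V.hash (x, π)

/-- The random oracle by which an ATM commits to a coin. -/
def coinTag (C : Coin G) (pkUser pkATM : G) : S.Act E σ (Bits lam) := do
  let d ← get
  let (y, ro) ← ((lazyRO (Coin G × G × G) (Bits lam) (C, pkUser, pkATM)).run d.ro : PMF _)
  set { d with ro := ro }
  pure y

/-! ### Withdrawal by a user -/

/-- The first message of a user: a commitment to its keys and a proof that the bank has signed
them. The opening is returned as well. -/
def withdrawRequest (i : Fin E.numUser) : StateT σ PMF (ZMod p × G × Option S.Proof) := do
  let u := k.user i
  let r ← unifZ p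
  let P := S.grp.comm ![u.sk, u.prfKey] r
  let π ← V.prove (.cert k.bank.zUser.1 P) (.cert ![u.sk, u.prfKey] r u.certRand u.cert)
  pure (r, P, π)

/-- Issuing a stored coin, with a voucher for the (already verified) request `(P, π)`. -/
def issueVoucher (j : Fin E.numATM) (e : StoredCoin p G) (P : G) (π : S.Proof) :
    StateT σ PMF (Option (Coin G × Voucher p G S.Proof)) := do
  let a := k.atm j
  let C := e.coin
  let rc := S.hashCom P
  let id := rc + 1
  let X := S.grp.prf e.k₁ id
  let Y := a.pk * gpow (S.grp.prf e.k₂ 0) rc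
  let πATM ← V.prove (.cert k.bank.zATM.1 C.Q) (.cert ![a.sk] e.rQ a.certRand a.cert)
  let πCoin ← V.prove (.coin C.K₁ C.K₂ X Y C.Q id rc) (.coin e.k₁ e.r₁ e.k₂ e.r₂ a.sk e.rQ)
  match πATM, πCoin with
  | some πA, some πC => pure (some (C, ⟨P, π, X, Y, πC, πA, rc⟩))
  | _, _ => pure none

/-- The signed promise of an ATM for an issued coin and voucher. -/
def makePromise (j : Fin E.numATM) (i : Fin E.numUser) (C : Coin G) (W : Voucher p G S.Proof) :
    S.Act E σ S.Promise := do
  let nonce ← (PMF.uniformOfFintype (Bits lam) : PMF (Bits lam))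
  let tag ← coinTag C (k.user i).pk (k.atm j).pk
  let s ← S.sgn.sign (k.atm j).sgk (.promise tag W nonce)
  modify fun d => { d with
    atmSession := Function.update d.atmSession j (d.atmSession j ++ [⟨i, nonce, C⟩]) }
  pure ⟨s, tag, W, nonce⟩

/-- The bank debits a user against a receipt, unless it is forged, was used before, contradicts a
complaint of the user, or overdraws the account. -/
def updateBal (i : Fin E.numUser) (rcpt : S.sgn.Sig) (j : Fin E.numATM) (nonce : Bits lam) :
    S.Act E σ Bool := do
  let d ← get
  if S.sgn.verify (k.user i).vk (.withdrawal (k.user i).pk (k.atm j).pk nonce) rcpt = true ∧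
      (i, j, nonce) ∉ d.settled ∧
      (∀ c ∈ d.invalid, ¬ (c.user = i ∧ c.atm = j ∧ c.promise.nonce = nonce)) ∧
      1 ≤ d.balance i then do
    set { d with
      settled := (i, j, nonce) :: d.settled
      balance := Function.update d.balance i (d.balance i - 1) }
    pure true
  else pure false

/-- An ATM receives a receipt, opens the coin, and informs the bank. -/
def receiveReceipt (j : Fin E.numATM) (s : ℕ) (rcpt : S.sgn.Sig) : S.Act E σ (Option (Coin G)) := do
  let d ← get
  match (d.atmSession j)[s]? with
  | none => pure none
  | some z =>
    if S.sgn.verify (k.user z.user).vk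
        (.withdrawal (k.user z.user).pk (k.atm j).pk z.nonce) rcpt = true then do
      let _ ← updateBal k z.user rcpt j z.nonce
      pure (some z.coin)
    else pure none

/-- A user answers a correctly signed promise with a receipt. -/
def receivePromise (i : Fin E.numUser) (s : ℕ) (j : Fin E.numATM) (w : S.Promise) :
    S.Act E σ (Option S.sgn.Sig) := do
  let d ← get
  match (d.userSession i)[s]? with
  | none => pure none
  | some z =>
    if S.sgn.verify (k.atm j).vk (.promise w.tag w.V w.nonce) w.sig = true then do
      set { d with
        userSession := Function.update d.userSession i
          ((d.userSession i).set s { z with promise := some (j, w) }) }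
      let rcpt ← S.sgn.sign (k.user i).sgk (.withdrawal (k.user i).pk (k.atm j).pk w.nonce)
      pure (some rcpt)
    else pure none

/-- A user receives the coin (`none` if the ATM does not send it). It stores a coin that agrees with
the promise, and complains to the bank otherwise. -/
def receiveCoin (i : Fin E.numUser) (s : ℕ) (C : Option (Coin G)) : S.Act E σ Bool := do
  let d ← get
  match (d.userSession i)[s]? with
  | some ⟨r, some (j, w)⟩ => do
    let good ← match C with
      | none => pure false
      | some C => do
          let tag ← coinTag C (k.user i).pk (k.atm j).pk
          pure (decide (tag = w.tag))
    match C, good with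
    | some C, true => do
        modify fun d => { d with
          wallet := Function.update d.wallet i (d.wallet i ++ [(C, w.V, r)]) }
        pure true
    | _, _ => do
        modify fun d => { d with invalid := ⟨i, j, w⟩ :: d.invalid }
        pure false
  | _ => pure false

/-! ### Spending and deposits -/

/-- Spending the coin number `n` of a user's wallet at merchant `m`, who chose `rv`. -/
def spendCoin (i : Fin E.numUser) (n : ℕ) (m : Fin E.numUser) (rv : Bits lam) :
    S.Act E σ (Option (Coin G × Voucher p G S.Proof × Tx p G S.Proof lam)) := do
  let d ← get
  match (d.wallet i)[n]? with
  | none => pure none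
  | some (C, W, r) => do
    let u := k.user i
    let rt := S.hashTx (k.user m).pk rv
    let id := W.rc + 1
    let Z := u.pk * gpow (S.grp.prf u.prfKey id) rt
    let π ← (V.prove (.tx W.P Z id rt) (.tx u.sk r u.prfKey) : StateT σ PMF _)
    match π with
    | none => pure none
    | some π => pure (some (C, W, ⟨Z, π, rv, rt⟩))

/-- Verification of a transaction at merchant `m`. -/
def verifyTx (C : Coin G) (W : Voucher p G S.Proof) (T : Tx p G S.Proof lam) (m : Fin E.numUser) :
    StateT σ PMF Bool := do
  let id := W.rc + 1
  let b₁ ← verifyProof V (.cert k.bank.zUser.1 W.P) W.πUser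
  let b₂ ← verifyProof V (.cert k.bank.zATM.1 C.Q) W.πATM
  let b₃ ← verifyProof V (.coin C.K₁ C.K₂ W.X W.Y C.Q id W.rc) W.πCoin
  let b₄ ← verifyProof V (.tx W.P T.Z id T.rt) T.πTx
  pure (decide (W.rc = S.hashCom W.P) && decide (T.rt = S.hashTx (k.user m).pk T.rv) &&
    S.bsgn.verify k.bank.rsa.N k.bank.rsa.e (S.hashCoin C.K₁ C.K₂ C.Q) C.sig &&
    b₁ && b₂ && b₃ && b₄)

/-- From tokens `A = pk * F ^ a` and `A' = pk * F ^ a'` with `a ≠ a'`, recover `pk`. -/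
def recoverKey (A A' : G) (a a' : ZMod p) : Option G :=
  if a = a' then none
  else
    let F := gpow (A / A') (a - a')⁻¹
    if A / gpow F a = A' / gpow F a' then some (A / gpow F a) else none

def traceUser (Z Z' : G) (rt rt' : ZMod p) : Outcome G :=
  match recoverKey Z Z' rt rt' with
  | some pk => .user pk
  | none => .abort

def traceATM (Y Y' : G) (rc rc' : ZMod p) : Outcome G :=
  match recoverKey Y Y' rc rc' with
  | some pk => .atm pk
  | none => .abort

/-- The first complaint that concerns the coin `C`. -/
def findComplaint (C : Coin G) : List (S.Complaint E) → S.Act E σ (Option (S.Complaint E))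
  | [] => pure none
  | c :: l => do
      let tag ← coinTag C (k.user c.user).pk (k.atm c.atm).pk
      if tag = c.promise.tag then pure (some c) else findComplaint C l

/-- The bank processes a deposit by merchant `m`, detecting double-spending and double-issuing. -/
def updateTx (C : Coin G) (W : Voucher p G S.Proof) (T : Tx p G S.Proof lam) (m : Fin E.numUser) :
    S.Act E σ (Outcome G) := do
  let ok ← (verifyTx V k C W T m : StateT σ PMF Bool)
  if ok = false then pure .abort
  else do
    let d ← get
    let found ← findComplaint k C d.invalid
    match found with
    | some c =>
        if W = c.promise.V then pure (.user (k.user c.user).pk)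
        else pure (traceATM W.Y c.promise.V.Y W.rc c.promise.V.rc)
    | none =>
        let same := d.log.filter fun l => decide (l.C = C)
        if same = [] then do
          modify fun d => { d with
            log := ⟨C, W.rc + 1, W.Y, T.Z, W.rc, T.rt⟩ :: d.log
            balance := Function.update d.balance m (d.balance m + 1) }
          pure .accepted
        else
          match same.find? fun l => decide (l.id = W.rc + 1 ∧ l.Y = W.Y ∧ l.rc = W.rc) with
          | some l => pure (traceUser T.Z l.Z T.rt l.rt)
          | none =>
            match same.find? fun l => decide (l.Y ≠ W.Y) with
            | some l =>
                if W.rc = l.rc then pure (traceUser T.Z l.Z T.rt l.rt)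
                else pure (traceATM W.Y l.Y W.rc l.rc)
            | none => pure .abort

/-! ### The oracle of the adversary -/

variable (S E) in
/-- The queries of the adversary: random oracles, honest ATMs, honest users, and the bank. -/
inductive Query
  | hash (x : List Bool)
  | coinTag (C : Coin G) (pkUser pkATM : G)
  | atmReqCoin (j : Fin E.numATM) (n : ℕ)
  | atmIssue (j : Fin E.numATM) (i : Fin E.numUser) (P : G) (π : S.Proof)
  | atmReceipt (j : Fin E.numATM) (s : ℕ) (rcpt : S.sgn.Sig)
  | userWithdraw (i : Fin E.numUser)
  | userPromise (i : Fin E.numUser) (s : ℕ) (j : Fin E.numATM) (w : S.Promise)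
  | userCoin (i : Fin E.numUser) (s : ℕ) (C : Option (Coin G))
  | userSpend (i : Fin E.numUser) (n : ℕ) (m : Fin E.numUser) (rv : Bits lam)
  | userNonce (m : Fin E.numUser)
  | userVerifyTx (m : Fin E.numUser) (s : ℕ) (C : Coin G) (W : Voucher p G S.Proof)
      (T : Tx p G S.Proof lam)
  | bankIssueCoin (K : ℕ)
  | bankUpdateBal (i : Fin E.numUser) (rcpt : S.sgn.Sig) (j : Fin E.numATM) (nonce : Bits lam)
  | bankAbortWithdrawal (c : S.Complaint E)
  | bankUpdateTx (C : Coin G) (W : Voucher p G S.Proof) (T : Tx p G S.Proof lam)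
      (m : Fin E.numUser)

variable (S) in
inductive Reply
  | abort
  | bits (y : Bits lam)
  | transcript (l : List (ℕ × ℕ))
  | promise (w : S.Promise)
  | coin (C : Coin G)
  | request (pk P : G) (π : S.Proof)
  | receipt (s : S.sgn.Sig)
  | payment (C : Coin G) (W : Voucher p G S.Proof) (T : Tx p G S.Proof lam)
  | flag (b : Bool)
  | signature (s : ℕ)
  | outcome (o : Outcome G)

/-- The queries that do not concern the key stores of the ATMs. -/
def answerDyn : S.Query E → S.Act E σ S.Reply
  | .hash x => do
      let y ← (V.hash x : StateT σ PMF _)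
      pure (.bits y)
  | .coinTag C pkU pkA => do
      let y ← coinTag C pkU pkA
      pure (.bits y)
  | .atmReceipt j s rcpt =>
      if j.val < E.honestATM then do
        let C ← receiveReceipt k j s rcpt
        pure (C.elim .abort .coin)
      else pure .abort
  | .userWithdraw i =>
      if i.val < E.honestUser then do
        let (r, P, π) ← (withdrawRequest V k i : StateT σ PMF _)
        match π with
        | none => pure .abort
        | some π => do
            modify fun d => { d with
              userSession := Function.update d.userSession i (d.userSession i ++ [⟨r, none⟩]) }
            pure (.request (k.user i).pk P π)
      else pure .abort
  | .userPromise i s j w =>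
      if i.val < E.honestUser then do
        let rcpt ← receivePromise k i s j w
        pure (rcpt.elim .abort .receipt)
      else pure .abort
  | .userCoin i s C =>
      if i.val < E.honestUser then do
        let b ← receiveCoin k i s C
        pure (.flag b)
      else pure .abort
  | .userSpend i n m rv =>
      if i.val < E.honestUser then do
        let z ← spendCoin V k i n m rv
        pure (z.elim .abort fun z => .payment z.1 z.2.1 z.2.2)
      else pure .abort
  | .userNonce m =>
      if m.val < E.honestUser then do
        let rv ← (PMF.uniformOfFintype (Bits lam) : PMF (Bits lam))
        modify fun d => { d with
          merchant := Function.update d.merchant m (d.merchant m ++ [rv]) }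
        pure (.bits rv)
      else pure .abort
  | .userVerifyTx m s C W T => do
      let d ← get
      if m.val < E.honestUser ∧ (d.merchant m)[s]? = some T.rv then do
        let ok ← (verifyTx V k C W T m : StateT σ PMF Bool)
        if ok = true then do
          let o ← updateTx V k C W T m
          pure (.outcome o)
        else pure .abort
      else pure .abort
  | .bankIssueCoin K => pure (.signature (RSABlind.sign k.bank.rsa K))
  | .bankUpdateBal i rcpt j nonce => do
      let b ← updateBal k i rcpt j nonce
      pure (.flag b)
  | .bankAbortWithdrawal c => do
      modify fun d => { d with invalid := c :: d.invalid }
      pure (.flag true)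
  | .bankUpdateTx C W T m => do
      let o ← updateTx V k C W T m
      pure (.outcome o)
  | .atmReqCoin _ _ => pure .abort
  | .atmIssue _ _ _ _ => pure .abort

/-- The answer of the honest ATMs, the honest users and the bank to a query. The adversary sees the
transcript of every coin withdrawal by an honest ATM. An ATM takes the coins from its key store in
the order in which they were withdrawn, and issues one only to a user who can pay for it. -/
def answer : S.Query E → StateT (S.Sys E) (StateT σ PMF) S.Reply
  | .atmReqCoin j n =>
      if j.val < E.honestATM ∧ n ≤ E.batch then do
        let y ← get
        let l ← sampleList (S.reqCoin y.keys.bank (y.keys.atm j)) n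
        set { y with
          store := Function.update y.store j (y.store j ++ l.map Prod.fst) }
        pure (.transcript (l.map Prod.snd))
      else pure .abort
  | .atmIssue j i P π =>
      if j.val < E.honestATM then do
        let y ← get
        let ok ← (verifyProof V (.cert y.keys.bank.zUser.1 P) π : StateT σ PMF Bool)
        match ok && decide (1 ≤ y.dyn.balance i), y.store j with
        | true, e :: rest => do
            let z ← (issueVoucher V y.keys j e P π : StateT σ PMF _)
            match z with
            | none => do
                set { y with store := Function.update y.store j rest }
                pure .abort
            | some (C, W) => do
                let (w, d) ← ((makePromise y.keys j i C W).run y.dyn : StateT σ PMF _)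
                set { y with store := Function.update y.store j rest, dyn := d }
                pure (.promise w)
        | _, _ => pure .abort
      else pure .abort
  | x => do
      let y ← get
      let (r, d) ← ((answerDyn V y.keys x).run y.dyn : StateT σ PMF _)
      set { y with dyn := d }
      pure r

/-! ### The untraceability experiment -/

variable (S E) in
/-- The input of the adversary: all public keys, the secrets of the dishonest parties, and the
transcripts of the initial coin withdrawals of the honest ATMs. -/
structure Public where
  rsaN : ℕ
  rsaE : ℕ
  zUser : S.zsgn.PK
  zATM : S.zsgn.PK
  vkBank : S.sgn.VK
  atm : Fin E.numATM → G × S.sgn.VK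
  user : Fin E.numUser → G × S.sgn.VK
  atmSecret : Fin E.numATM → Option S.ATM
  userSecret : Fin E.numUser → Option S.User
  transcripts : Fin E.numATM → List (ℕ × ℕ)

/-- Initial withdrawals: `E.stock` coins for every honest ATM. -/
def initialStock (B : S.Bank) (atm : Fin E.numATM → S.ATM) :
    (n : ℕ) → n ≤ E.numATM → PMF (Fin n → List (StoredCoin p G × (ℕ × ℕ)))
  | 0, _ => pure Fin.elim0
  | n + 1, hn => do
      let f ← initialStock B atm n (Nat.le_of_succ_le hn)
      let l ← sampleList (S.reqCoin B (atm ⟨n, hn⟩)) (if n < E.honestATM then E.stock else 0)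
      pure (Fin.snoc (α := fun _ => List (StoredCoin p G × (ℕ × ℕ))) f l)

variable (S E) in
/-- Initialization of the bank, the ATMs and the users. -/
def setup : PMF (S.Public E × S.Sys E) := do
  let B ← S.initBank
  let atm ← sampleFin (S.initATM B) E.numATM
  let user ← sampleFin (S.initUser B) E.numUser
  let st ← initialStock B atm E.numATM le_rfl
  pure (
    { rsaN := B.rsa.N
      rsaE := B.rsa.e
      zUser := B.zUser.1
      zATM := B.zATM.1
      vkBank := B.sig.1
      atm := fun j => ((atm j).pk, (atm j).vk)
      user := fun i => ((user i).pk, (user i).vk)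
      atmSecret := fun j => if j.val < E.honestATM then none else some (atm j)
      userSecret := fun i => if i.val < E.honestUser then none else some (user i)
      transcripts := fun j => (st j).map Prod.snd },
    { keys := ⟨B, atm, user⟩
      store := fun j => (st j).map Prod.fst
      dyn :=
        { ro := fun _ => none
          atmSession := fun _ => []
          userSession := fun _ => []
          wallet := fun _ => []
          merchant := fun _ => []
          balance := E.balance
          settled := []
          log := []
          invalid := [] }
      aborted := false })

variable (E) in
/-- The choice of the adversary: two ATMs and a user. -/
abbrev Choice : Type := (Fin E.numATM × Fin E.numATM) × Fin E.numUser

/-- The challenge: for an admissible choice `((j₀, j₁), i)` the user `i` withdraws from the ATM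
`j_b`; the resulting coin and voucher are put into the user's wallet and given to the adversary. For
an inadmissible choice, or if the withdrawal aborts, the experiment is marked as aborted. -/
def challenge (b : Bool) : Choice E × S.Sys E →
    StateT σ PMF (Option (Coin G × Voucher p G S.Proof) × S.Sys E)
  | (((j₀, j₁), i), y) =>
    if j₀.val < E.honestATM ∧ j₁.val < E.honestATM ∧ j₀ ≠ j₁ ∧ i.val < E.honestUser then do
      let j := if b then j₁ else j₀
      let (r, P, π) ← withdrawRequest V y.keys i
      match π with
      | none => pure (none, { y with aborted := true })
      | some π => do
        let ok ← verifyProof V (.cert y.keys.bank.zUser.1 P) π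
        match ok && decide (1 ≤ y.dyn.balance i), y.store j with
        | true, e :: rest => do
            let z ← issueVoucher V y.keys j e P π
            match z with
            | none => pure (none, { y with aborted := true })
            | some (C, W) =>
                pure (some (C, W), { y with
                  store := Function.update y.store j rest
                  dyn := { y.dyn with
                    wallet := Function.update y.dyn.wallet i (y.dyn.wallet i ++ [(C, W, r)]) } })
        | _, _ => pure (none, { y with aborted := true })
    else pure (none, { y with aborted := true })

/-- The result of the experiment: the guess of the adversary, or `0` if it was aborted. -/
def verdict (x : Bool × S.Sys E) : Bool := !x.2.aborted && x.1

variable (S E) in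
/-- An untraceability adversary: two algorithms that share a memory. -/
structure Adversary where
  Mem : Type
  first : Prog (S.Query E) S.Reply (S.Public E) (Choice E × Mem)
  second : Prog (S.Query E) S.Reply (Option (Coin G × Voucher p G S.Proof) × Mem) Bool

def Adversary.cost (c : CostModel) (A : S.Adversary E) : ℕ∞ := A.first.cost c + A.second.cost c

def Adversary.calls (A : S.Adversary E) : ℕ := A.first.calls + A.second.calls

/-- The untraceability experiment with bit `b`. -/
def experiment (b : Bool) (A : S.Adversary E) : StateT σ PMF Bool := do
  let (pub, y₀) ← S.setup E
  let ((ch, mem), y₁) ← (A.first.eval (answer V) pub).run y₀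
  let (cv, y₂) ← challenge V b (ch, y₁)
  let (guess, y₃) ← (A.second.eval (answer V) (cv, mem)).run y₂
  pure (verdict (guess, y₃))

/-- The probability that the experiment, with the random oracle and the real prover, returns `1`. -/
def winProb (b : Bool) (A : S.Adversary E) : ℝ :=
  prob ((experiment S.nizk.real b A).run' (fun _ => none))

variable (S E) in
/-- The untraceability advantage for time `t` and `q` oracle queries. -/
def untraceAdv (c : CostModel) (t : ℕ∞) (q : ℕ) : ℝ :=
  ⨆ A : {A : S.Adversary E // A.cost c ≤ t ∧ A.calls ≤ q}, winProb true A.1 - winProb false A.1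

/-! ### The cost of the honest parties -/

variable (S) in
/-- The procedure `f`, with access to a random oracle and a prover, is carried out by an algorithm
of running time `τ` which makes `n` calls to the two. -/
def RunsIn {α β : Type} (c : CostModel) (τ : ℕ∞) (n : ℕ)
    (f : (σ : Type) → S.Svc σ → α → StateT σ PMF β) : Prop :=
  ∃ P : Prog (List Bool ⊕ Stmt p G S.zsgn.PK × Wit p S.zsgn.Sig) (Bits lam ⊕ Option S.Proof) α β,
    P.cost c ≤ τ ∧ P.calls ≤ n ∧ ∀ (σ : Type) (V : S.Svc σ) (a : α), P.eval V.oracle a = f σ V a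

/-- `answer`, where no query (`none`) gets no answer. -/
def answerOption : Option (S.Query E) × S.Sys E → StateT σ PMF (Option S.Reply × S.Sys E)
  | (none, y) => pure (none, y)
  | (some x, y) => do
      let (r, y') ← (answer V x).run y
      pure (some r, y')

variable (S E) in
/-- Each procedure that the experiment performs besides running the adversary (the initialization,
the answer to one query, the challenge, and the computation of the result) takes time at most `τ`
and at most `n` calls to the random oracle and the prover. -/
structure HonestCost (c : CostModel) (τ : ℕ∞) (n : ℕ) : Prop where
  init : S.RunsIn c τ n (fun _ _ (_ : Unit) => (liftM (S.setup E) : StateT _ PMF _))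
  answer : S.RunsIn c τ n (fun _ V => answerOption (E := E) V)
  challenge : ∀ b, S.RunsIn c τ n (fun _ V => challenge (E := E) V b)
  verdict : S.RunsIn c τ n
    (fun _ _ (x : Bool × S.Sys E) => (pure (verdict x) : StateT _ PMF Bool))

end Scheme

end ECash

end

noncomputable section

namespace ECash

/-! ## Running an algorithm together with the party that answers its queries -/

/-! Once the proofs are simulated, the experiments for `b = 0` and `b = 1` are literally the same
computation. The passage from real to simulated proofs costs one zero-knowledge advantage per bit,
hence two in all.

What an ATM issues then carries no trace of the ATM. With uniform randomness, each of the
commitments `K₁`, `K₂`, `Q` is uniform in the group, because `h` is a generator. Each PRF key of a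
coin is evaluated at one point only, and `k ↦ F_k(x)` is a bijection for fixed `x`; so `X` is
uniform, and so is `Y`, since raising to the nonzero power `r_c` and multiplying by `pk_j` are
bijections. The signature of the bank is `H(m) ^ d` after unblinding, a function of the commitments
alone, while the blinded message is uniform and independent of the coin. Thus
`freshCoin_bind_issueVoucher` turns the challenge into `randomVoucher`, in which the ATM does not
occur.

The bit still decides which key store loses a coin. By deferred sampling a store is a list of fresh
coins about which nothing is known except its length, and the length shows only when the store is
empty. `StoreIndist k r` expresses this: results agree for any two vectors of store lengths that are
at least `r` at the honest ATMs. It is carried backwards from the verdict through the second phase,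
the challenge and the first phase; every query and the challenge raise `r` by one, and `q < s` pays
for all of them.

For the zero-knowledge step, the whole experiment is turned into one distinguisher (`Prog.attach`,
`exists_distinguisher`), the parties being run as subroutines of the adversary's program. -/

/-- The algorithm that runs `P` and answers its queries with `ans`, which keeps a state in `Y`. -/
def Prog.attach {Q R Q' R' Y : Type} (ans : Prog Q' R' (Option Q × Y) (Option R × Y)) :
    {α β : Type} → Prog Q R α β → Prog Q' R' (α × Y) (β × Y)
  | _, _, .step f => .frame Y (.step f)
  | _, _, .call => ans
  | _, _, .seq P P' => .seq (Prog.attach ans P) (Prog.attach ans P')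
  -- The state `Y` has to stand next to the part of the memory on which `P` works, so it changes
  -- places with `γ` before and after; swaps are free.
  | _, _, .frame γ P => .seq (.swap _ γ Y) (.seq (.frame γ (Prog.attach ans P)) (.swap _ Y γ))
  | _, _, .swap α β γ => .frame Y (.swap α β γ)

section Attach

variable {Q R Q' R' Y : Type} (ans : Prog Q' R' (Option Q × Y) (Option R × Y))

theorem Prog.calls_attach {n : ℕ} (hn : ans.calls ≤ n) {α β : Type} (P : Prog Q R α β) :
    (Prog.attach ans P).calls ≤ P.calls * n := by
  induction P with
  | step f => simp [Prog.attach, Prog.calls]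
  | call => simpa [Prog.attach, Prog.calls] using hn
  | seq P P' h h' =>
      simp only [Prog.attach, Prog.calls, add_mul]
      exact add_le_add h h'
  | frame γ P h => simpa [Prog.attach, Prog.calls] using h
  | swap α β γ => simp [Prog.attach, Prog.calls]

theorem Prog.cost_attach {c : CostModel} {τ : ℕ∞} (hτ : ans.cost c ≤ τ) {α β : Type}
    (P : Prog Q R α β) : (Prog.attach ans P).cost c ≤ P.cost c + P.calls * τ := by
  induction P with
  | step f => simp [Prog.attach, Prog.calls, Prog.cost]
  | call =>
      simp only [Prog.attach, Prog.calls, Prog.cost, Nat.cast_one, one_mul]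
      -- The replaced gate was charged `1` in `P`; this unit is given away.
      exact hτ.trans le_add_self
  | seq P P' h h' =>
      simp only [Prog.attach, Prog.calls, Prog.cost, Nat.cast_add, add_mul]
      exact (add_le_add h h').trans_eq (add_add_add_comm _ _ _ _)
  | frame γ P h => simpa [Prog.attach, Prog.calls, Prog.cost] using h
  | swap α β γ => simp [Prog.attach, Prog.calls, Prog.cost]

theorem Prog.eval_attach {σ : Type} (O' : Q' → StateT σ PMF R')
    (O : Q → StateT Y (StateT σ PMF) R)
    (hnone : ∀ y, ans.eval O' (none, y) = pure (none, y))
    (hsome : ∀ x y, ans.eval O' (some x, y) = (do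
      let (r, y') ← (O x).run y
      pure (some r, y')))
    {α β : Type} (P : Prog Q R α β) (a : α) (y : Y) :
    (Prog.attach ans P).eval O' (a, y) = (P.eval O a).run y := by
  induction P generalizing y with
  | step f => simp [Prog.attach, Prog.eval, liftM]
  | call =>
      cases a with
      | none => simp [Prog.attach, Prog.eval, hnone]
      | some x => simp [Prog.attach, Prog.eval, hsome]
  | seq P P' h h' => simp [Prog.attach, Prog.eval, h, h']
  | frame γ P h => obtain ⟨a, z⟩ := a; simp [Prog.attach, Prog.eval, h]
  | swap α β γ => obtain ⟨⟨a, b⟩, z⟩ := a; simp [Prog.attach, Prog.eval]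

end Attach

/-! ### Probabilities, advantages, and the passage to simulated proofs. -/

theorem prob_nonneg (e : PMF Bool) : 0 ≤ prob e := ENNReal.toReal_nonneg

theorem prob_le_one (e : PMF Bool) : prob e ≤ 1 :=
  ENNReal.toReal_le_of_le_ofReal zero_le_one (by simpa using e.coe_le_one true)

theorem abs_prob_sub_le_one (e e' : PMF Bool) : |prob e - prob e'| ≤ 1 := by
  rw [abs_le]
  constructor <;> linarith [prob_nonneg e, prob_nonneg e', prob_le_one e, prob_le_one e']

/-- A real supremum dominates its members only if the family is bounded above; here `1` is a bound,
as for any difference of probabilities. -/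
theorem NIZK.abs_sub_le_zkAdv {lam : ℕ} {S W : Type} {R : S → W → Prop} (N : NIZK lam R)
    (c : CostModel) {t : ℕ∞} {q : ℕ} (D : N.Distinguisher) (ht : D.cost c ≤ t)
    (hq : D.calls ≤ q) : |prob (N.zkSim D) - prob (N.zkReal D)| ≤ N.zkAdv c t q :=
  le_ciSup (f := fun D : {D : N.Distinguisher // D.cost c ≤ t ∧ D.calls ≤ q} =>
      |prob (N.zkSim D.1) - prob (N.zkReal D.1)|)
    ⟨1, by rintro _ ⟨D, rfl⟩; exact abs_prob_sub_le_one _ _⟩ ⟨D, ht, hq⟩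

namespace Scheme

variable {p : ℕ} [Fact p.Prime] {G : Type} [CommGroup G] [Fintype G] {lam : ℕ}
variable {S : Scheme p G lam} {E : Setting}

/-- The experiment, run by an algorithm that has access to a random oracle and a prover only. -/
theorem exists_distinguisher {c : CostModel} {τ : ℕ∞} {n : ℕ} (hcost : S.HonestCost E c τ n)
    (A : S.Adversary E) (b : Bool) :
    ∃ D : S.nizk.Distinguisher, D.cost c ≤ A.cost c + (A.calls + 3) * τ ∧
      D.calls ≤ (A.calls + 3) * n ∧
      ∀ (σ : Type) (V : S.Svc σ), D.eval V.oracle () = experiment V b A := by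
  obtain ⟨Pi, hi, hi', hi''⟩ := hcost.init
  obtain ⟨Pa, ha, ha', ha''⟩ := hcost.answer
  obtain ⟨Pc, hc, hc', hc''⟩ := hcost.challenge b
  obtain ⟨Pv, hv, hv', hv''⟩ := hcost.verdict
  -- `Pi`, `Pc` and `Pv` account for the summand `3`. The swaps around `Pc` set the memory of the
  -- adversary aside, so that the challenge sees only the choice and the system.
  refine ⟨.seq Pi (.seq (Prog.attach Pa A.first) (.seq (.swap _ _ _) (.seq (.frame _ Pc)
    (.seq (.swap _ _ _) (.seq (Prog.attach Pa A.second) Pv))))), ?_, ?_, ?_⟩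
  · simp only [Prog.cost, zero_add]
    calc _ ≤ τ + (A.first.cost c + A.first.calls * τ + (τ +
        (A.second.cost c + A.second.calls * τ + τ))) := by
          gcongr
          · exact Prog.cost_attach _ ha _
          · exact Prog.cost_attach _ ha _
      _ = _ := by simp only [Adversary.cost, Adversary.calls]; push_cast; ring
  · simp only [Prog.calls, zero_add]
    calc _ ≤ n + (A.first.calls * n + (n + (A.second.calls * n + n))) := by
          gcongr
          · exact Prog.calls_attach _ ha' _
          · exact Prog.calls_attach _ ha' _
      _ = _ := by simp only [Adversary.calls]; ring
  · intro σ V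
    have key : ∀ {α β : Type} (P : Prog (S.Query E) S.Reply α β) (a : α) (y : S.Sys E),
        (Prog.attach Pa P).eval V.oracle (a, y) = (P.eval (answer V) a).run y :=
      fun P a y => Prog.eval_attach Pa V.oracle (answer V) (fun y => by rw [ha'']; rfl)
        (fun x y => by rw [ha'']; rfl) P a y
    simp only [Prog.eval, hi'', hv'', experiment, bind_assoc, pure_bind]
    refine bind_congr fun x => ?_
    obtain ⟨pub, y₀⟩ := x
    rw [key]
    refine bind_congr fun x => ?_
    obtain ⟨⟨ch, mem⟩, y₁⟩ := x
    simp only [hc'']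
    refine bind_congr fun x => ?_
    obtain ⟨cv, y₂⟩ := x
    simp only [key]

/-- The probability that the experiment with the simulator returns `1`. -/
def simProb (b : Bool) (A : S.Adversary E) : ℝ :=
  prob (S.nizk.simInit >>= fun s => (experiment S.nizk.simulated b A).run' s)

/-- The distinguisher is one program that reproduces the experiment for every service, so it can be
run both with the real prover and with the simulator. -/
theorem abs_simProb_sub_winProb_le {c : CostModel} {t τ : ℕ∞} {q n : ℕ}
    (hcost : S.HonestCost E c τ n) (A : S.Adversary E) (ht : A.cost c ≤ t) (hq : A.calls ≤ q)
    (b : Bool) :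
    |simProb b A - winProb b A| ≤ S.nizk.zkAdv c (t + (q + 3) * τ) ((q + 3) * n) := by
  obtain ⟨D, h₁, h₂, h₃⟩ := exists_distinguisher hcost A b
  have h := S.nizk.abs_sub_le_zkAdv c (t := t + (q + 3) * τ) (q := (q + 3) * n) D
    (h₁.trans (by gcongr)) (h₂.trans (by gcongr))
  simpa only [NIZK.zkSim, NIZK.zkReal, h₃, simProb, winProb] using h

end Scheme

/-! ## Sampling -/

theorem pmf_bind_comm {α β γ : Type} (d : PMF α) (e : PMF β) (f : α → β → PMF γ) :
    (d >>= fun a => e >>= fun b => f a b) = e >>= fun b => d >>= fun a => f a b :=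
  PMF.bind_comm d e f

section Lift

variable {σ α β γ : Type}

theorem lift_bind_run (d : PMF α) (f : α → StateT σ PMF β) (s : σ) :
    ((liftM d : StateT σ PMF α) >>= f).run s = d >>= fun a => (f a).run s := by
  simp [liftM]

/-- A sampling step commutes with every other step. -/
theorem lift_bind_comm (d : PMF α) (x : StateT σ PMF β) (f : α → β → StateT σ PMF γ) :
    ((liftM d : StateT σ PMF α) >>= fun a => x >>= fun b => f a b) =
      x >>= fun b => (liftM d : StateT σ PMF α) >>= fun a => f a b := by
  ext1 s
  rw [lift_bind_run, StateT.run_bind]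
  simp only [StateT.run_bind x, fun (b : β) s => lift_bind_run d (fun a => f a b) s]
  exact pmf_bind_comm _ _ _

theorem lift_bind (d : PMF α) (f : α → PMF β) :
    (liftM (d >>= f) : StateT σ PMF β) = liftM d >>= fun a => liftM (f a) := by
  ext1 s
  simp [liftM]

theorem lift_pure (a : α) : (liftM (pure a : PMF α) : StateT σ PMF α) = pure a := by
  ext1 s
  simp [liftM]

/-- A `PMF` has total mass `1` and leaves the state alone. This discards the key stores at the end
of the experiment, where nobody reads them. -/
theorem lift_bind_const (d : PMF α) (x : StateT σ PMF β) :
    ((liftM d : StateT σ PMF α) >>= fun _ => x) = x := by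
  ext1 s
  rw [lift_bind_run]
  exact PMF.bind_const d (x.run s)

/-- Values outside the support have weight `0`. Needed because the certificates are valid only for
keys that can really be generated. -/
theorem lift_bind_congr (d : PMF α) {f g : α → StateT σ PMF β} (h : ∀ a ∈ d.support, f a = g a) :
    ((liftM d : StateT σ PMF α) >>= f) = liftM d >>= g := by
  ext1 s
  rw [lift_bind_run, lift_bind_run]
  refine PMF.ext fun b => ?_
  change (d.bind _) b = (d.bind _) b
  rw [PMF.bind_apply, PMF.bind_apply]
  refine tsum_congr fun a => ?_
  by_cases ha : a ∈ d.support
  · rw [h a ha]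
  · rw [PMF.mem_support_iff, not_not] at ha
    simp [ha]

end Lift

/-- The image of a uniform sample under a bijection is a uniform sample. -/
theorem uniform_bind_bijective {α β γ : Type} [Fintype α] [Nonempty α] [Fintype β] [Nonempty β]
    {f : α → β} (hf : Function.Bijective f) (k : β → PMF γ) :
    (PMF.uniformOfFintype α >>= fun a => k (f a)) = PMF.uniformOfFintype β >>= k := by
  refine PMF.ext fun c => ?_
  change ((PMF.uniformOfFintype α).bind fun a => k (f a)) c =
    ((PMF.uniformOfFintype β).bind k) c
  rw [PMF.bind_apply, PMF.bind_apply,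
    ← (Equiv.ofBijective f hf).tsum_eq fun b => PMF.uniformOfFintype β b * k b c]
  refine tsum_congr fun a => ?_
  rw [PMF.uniformOfFintype_apply, PMF.uniformOfFintype_apply, Fintype.card_of_bijective hf]
  rfl

theorem mem_support_sampleFin {α : Type} {d : PMF α} {n : ℕ} {f : Fin n → α}
    (hf : f ∈ (sampleFin d n).support) (i : Fin n) : f i ∈ d.support := by
  induction n with
  | zero => exact i.elim0
  | succ n ih =>
      change f ∈ (d.bind fun a => (sampleFin d n).bind fun f => 
        PMF.pure (Fin.cons (α := fun _ => α) a f)).support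
        at hf
      simp only [PMF.mem_support_bind_iff, PMF.mem_support_pure_iff] at hf
      obtain ⟨a, ha, f', hf', rfl⟩ := hf
      refine Fin.cases ?_ (fun i => ?_) i
      · simpa using ha
      · simpa using ih hf' i

theorem sampleList_add {α : Type} (d : PMF α) (m n : ℕ) :
    sampleList d (m + n) =
      sampleList d m >>= fun l => sampleList d n >>= fun l' => pure (l ++ l') := by
  induction m with
  | zero => simp [sampleList]
  | succ m ih => simp [Nat.succ_add, sampleList, ih]

/-- Lists of independent pairs are independent pairs of lists. -/
theorem sampleList_prod {α β γ : Type} (d : PMF α) (e : PMF β) (n : ℕ)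
    (k : List α → List β → PMF γ) :
    (sampleList (d >>= fun a => e >>= fun b => pure (a, b)) n >>=
        fun l => k (l.map Prod.fst) (l.map Prod.snd)) =
      sampleList d n >>= fun l => sampleList e n >>= fun l' => k l l' := by
  induction n generalizing k with
  | zero => simp [sampleList]
  | succ n ih =>
      simp only [sampleList, bind_assoc, pure_bind, List.map_cons]
      refine bind_congr fun a => ?_
      simp only [fun b => ih fun l l' => k (a :: l) (b :: l')]
      exact pmf_bind_comm _ _ _

/-- Independent samples from a finite family of distributions. -/
def sampleFamily {α : Type} : {n : ℕ} → (Fin n → PMF α) → PMF (Fin n → α)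
  | 0, _ => pure Fin.elim0
  | n + 1, d => do
      let f ← sampleFamily fun i : Fin n => d i.castSucc
      let x ← d (Fin.last n)
      pure (Fin.snoc (α := fun _ => α) f x)

/-- By independence of the coordinates, processing one of them before or after the others are drawn
makes no difference. Applied to key stores, `T` adds coins to the store of one ATM. -/
theorem sampleFamily_update {α : Type} {n : ℕ} (d : Fin n → PMF α) (j : Fin n) (T : α → PMF α) :
    sampleFamily (Function.update d j (d j >>= T)) =
      sampleFamily d >>= fun f => T (f j) >>= fun x => pure (Function.update f j x) := by
  induction n with
  | zero => exact j.elim0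
  | succ n ih =>
      refine Fin.lastCases ?_ (fun j => ?_) j
      · simp only [sampleFamily, ne_eq, Fin.castSucc_ne_last, not_false_eq_true,
          Function.update_of_ne, Function.update_self, bind_assoc, pure_bind, Fin.snoc_last,
          Fin.update_snoc_last]
      · have h : (fun i : Fin n => Function.update d j.castSucc (d j.castSucc >>= T) i.castSucc) =
            Function.update (fun i => d i.castSucc) j (d j.castSucc >>= T) := by
          funext i
          by_cases hi : i = j
          · subst hi; simp
          · simp [hi]
        simp only [sampleFamily, h, ih, bind_assoc, pure_bind, Fin.snoc_castSucc]
        refine bind_congr fun f => ?_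
        rw [pmf_bind_comm]
        simp [Function.update_of_ne, (Fin.castSucc_ne_last j).symm, Fin.snoc_update]

/-- A family of independent pairs is an independent pair of families. -/
theorem sampleFamily_prod {α β δ γ : Type} {n : ℕ} (x : α → β) (y : α → δ) (d : Fin n → PMF α)
    (e : Fin n → PMF β) (e' : Fin n → PMF δ)
    (h : ∀ (i) (k : β → δ → PMF γ), (d i >>= fun a => k (x a) (y a)) =
      e i >>= fun b => e' i >>= fun c => k b c) (k : (Fin n → β) → (Fin n → δ) → PMF γ) :
    (sampleFamily d >>= fun f => k (fun i => x (f i)) (fun i => y (f i))) =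
      sampleFamily e >>= fun f => sampleFamily e' >>= fun f' => k f f' := by
  induction n with
  | zero => simp [sampleFamily]; congr 1 <;> exact funext fun i => i.elim0
  | succ n ih =>
      simp only [sampleFamily, bind_assoc, pure_bind]
      have hs : ∀ {ε : Type} (z : α → ε) (f : Fin n → α) (a : α),
          (fun i => z (Fin.snoc (α := fun _ => α) f a i)) =
            Fin.snoc (α := fun _ => ε) (fun i => z (f i)) (z a) := fun z f a => by
        funext i
        refine Fin.lastCases ?_ (fun i => ?_) i <;> simp
      simp only [hs]
      rw [ih (fun i => d i.castSucc) (fun i => e i.castSucc) (fun i => e' i.castSucc)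
        (fun i k => h _ k) fun f f' => d (Fin.last n) >>= fun a =>
          k (Fin.snoc (α := fun _ => β) f (x a)) (Fin.snoc (α := fun _ => δ) f' (y a))]
      refine bind_congr fun f => ?_
      simp only [fun f' => h (Fin.last n) fun b c => k (Fin.snoc (α := fun _ => β) f b)
        (Fin.snoc (α := fun _ => δ) f' c)]
      exact pmf_bind_comm _ _ _

/-! ### Sampling identities inside computations with state. -/

theorem lift_bind_map {σ α β γ : Type} (d : PMF α) (f : α → β) (K : β → StateT σ PMF γ) :
    ((liftM d : StateT σ PMF α) >>= fun a => K (f a)) =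
      (liftM (d >>= fun a => pure (f a) : PMF β) : StateT σ PMF β) >>= K := by
  simp only [lift_bind, lift_pure, bind_assoc, pure_bind]

theorem lift_uniform_bind_bijective {σ α β γ : Type} [Fintype α] [Nonempty α] [Fintype β]
    [Nonempty β] {f : α → β} (hf : Function.Bijective f) (K : β → StateT σ PMF γ) :
    ((liftM (PMF.uniformOfFintype α) : StateT σ PMF α) >>= fun a => K (f a)) =
      (liftM (PMF.uniformOfFintype β) : StateT σ PMF β) >>= K := by
  rw [lift_bind_map, uniform_bind_bijective hf, bind_pure]

theorem lift_sampleList_prod {σ α β γ : Type} (d : PMF α) (e : PMF β) (n : ℕ)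
    (K : List α → List β → StateT σ PMF γ) :
    ((liftM (sampleList (d >>= fun a => e >>= fun b => pure (a, b)) n) : StateT σ PMF _) >>=
        fun l => K (l.map Prod.fst) (l.map Prod.snd)) =
      (liftM (sampleList d n) : StateT σ PMF _) >>= fun l =>
        (liftM (sampleList e n) : StateT σ PMF _) >>= fun l' => K l l' := by
  rw [lift_bind_map _ (fun l : List (α × β) => (l.map Prod.fst, l.map Prod.snd)) fun z => K z.1 z.2,
    sampleList_prod d e n fun l l' => pure (l, l')]
  simp only [lift_bind, lift_pure, bind_assoc, pure_bind]

/-! ## The group -/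

section Group

variable {p : ℕ} [Fact p.Prime] {G : Type} [CommGroup G] [Fintype G]

/-- In a group of prime order `p` every element other than `1` has order `p`. -/
theorem GroupParams.gpow_bijective (pp : GroupParams p G) {x : G} (hx : x ≠ 1) :
    Function.Bijective fun a : ZMod p => gpow x a := by
  have hp : p.Prime := Fact.out
  have hcard : Nat.card G = p := by rw [Nat.card_eq_fintype_card, pp.card_eq]
  have hord : orderOf x = p :=
    ((Nat.dvd_prime hp).1 (hcard ▸ orderOf_dvd_natCard x)).resolve_left
      (fun h => hx (orderOf_eq_one_iff.1 h))
  rw [Fintype.bijective_iff_injective_and_card, pp.card_eq, ZMod.card]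
  refine ⟨fun a b hab => ZMod.val_injective p ?_, rfl⟩
  exact pow_injOn_Iio_orderOf (by simpa [hord] using a.val_lt) (by simpa [hord] using b.val_lt) hab

/-- A nonzero exponent is coprime to the group order. This is where nonzero hash values matter: with
`r_c = 0` the token `Y` would be `pk_j`. -/
theorem GroupParams.gpow_left_bijective (pp : GroupParams p G) {a : ZMod p}
    (ha : a ≠ 0) :
    Function.Bijective fun x : G => gpow x a := by
  have hp : p.Prime := Fact.out
  have hcop : (Nat.card G).Coprime a.val := by
    rw [Nat.card_eq_fintype_card, pp.card_eq]
    exact (Nat.coprime_of_lt_prime ((ZMod.val_ne_zero a).2 ha) a.val_lt hp)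
  exact (powCoprime hcop).bijective

/-- Perfect hiding: with the messages fixed, uniform randomness gives a uniform commitment. -/
theorem GroupParams.comm_bijective (pp : GroupParams p G) {n : ℕ} (m : Fin n → ZMod p) :
    Function.Bijective (pp.comm m) :=
  (Group.mulLeft_bijective _).comp (pp.gpow_bijective pp.h_ne)

/-- Since `0⁻¹ = 0`, inversion is an involution of all of `ZMod p`, and there is no exceptional key.
A single value under a uniform key is therefore exactly uniform. -/
theorem GroupParams.prf_bijective (pp : GroupParams p G) (x : ZMod p) :
    Function.Bijective fun k => pp.prf k x :=
  (pp.gpow_bijective pp.g_ne).comp (inv_involutive.bijective.comp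
    ((AddGroup.addRight_bijective x).comp (AddGroup.addLeft_bijective 1)))

end Group

/-! ## RSA -/

namespace RSABlind

/-- The order of a unit divides `φ(N)`, and `e * d ≡ 1` modulo `φ(N)`. -/
theorem _root_.ECash.RSAKey.pow_mul_eq (K : RSAKey) (r : (ZMod K.N)ˣ) : r ^ (K.e * K.d) = r := by
  have h := pow_eq_pow_iff_modEq (x := r) (n := K.e * K.d) (m := 1)
  rw [pow_one] at h
  refine h.2 (K.hed.of_dvd (orderOf_dvd_of_pow_eq_one ?_))
  exact ZMod.pow_totient r

variable {Msg : Type} (B : RSABlind Msg)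

/-- The full-domain-hash signature. -/
def fdhSign (K : RSAKey) (m : Msg) : ℕ := (((B.fdh K.N m) ^ K.d : (ZMod K.N)ˣ) : ZMod K.N).val

/-- `(H(m) * r ^ e) ^ d * r⁻¹ = H(m) ^ d`: the blinding factor cancels, so the finished coin does
not depend on it. -/
theorem unblind_sign_blind (K : RSAKey) (m : Msg) (r : (ZMod K.N)ˣ) :
    unblind K (sign K (B.blind K m r)) r = B.fdhSign K m := by
  simp only [unblind, sign, blind, fdhSign, ZMod.natCast_zmod_val, ← Units.val_pow_eq_pow_val,
    ← Units.val_mul]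
  rw [mul_pow, ← pow_mul, K.pow_mul_eq, mul_inv_cancel_right]

/-- Taking `d`-th powers undoes `r ↦ r ^ e`, and an injective self-map of a finite set is bijective.
Hence the blinded message is uniform for every `m`. -/
theorem blind_bijective (K : RSAKey) (m : Msg) :
    Function.Bijective fun r : (ZMod K.N)ˣ => B.fdh K.N m * r ^ K.e := by
  refine (Group.mulLeft_bijective _).comp (Finite.injective_iff_bijective.1 fun r s h => ?_)
  have h' := congrArg (· ^ K.d) h
  simpa only [← pow_mul, K.pow_mul_eq] using h'

/-- The transcript of a blind signature: a uniformly random blinded message and the answer of the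
signer. -/
def transcript (K : RSAKey) : PMF (ℕ × ℕ) := do
  let u ← (PMF.uniformOfFintype (ZMod K.N)ˣ : PMF (ZMod K.N)ˣ)
  pure ((u : ZMod K.N).val, sign K (u : ZMod K.N).val)

end RSABlind

/-! ### Withdrawn coins and their transcripts. -/

namespace Scheme

variable {p : ℕ} [Fact p.Prime] {G : Type} [CommGroup G] [Fintype G] {lam : ℕ}
variable {S : Scheme p G lam} {E : Setting}

/-- The coin with commitments `K₁`, `K₂`, `Q`, signed by the bank. -/
def signedCoin (B : S.Bank) (K₁ K₂ Q : G) : Coin G :=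
  ⟨K₁, K₂, Q, S.bsgn.fdhSign B.rsa (S.hashCoin K₁ K₂ Q)⟩

/-- A coin as an ATM withdraws it, without the transcript. -/
def freshCoin (B : S.Bank) (a : S.ATM) : PMF (StoredCoin p G) := do
  let k₁ ← unifZ p
  let k₂ ← unifZ p
  let r₁ ← unifZ p
  let r₂ ← unifZ p
  let rQ ← unifZ p
  pure ⟨signedCoin B (S.grp.comm ![k₁] r₁) (S.grp.comm ![k₂] r₂) (S.grp.comm ![a.sk] rQ),
    k₁, r₁, k₂, r₂, rQ⟩

/-- Blindness: a withdrawn coin is independent of the transcript of its withdrawal. -/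
theorem reqCoin_eq (B : S.Bank) (a : S.ATM) :
    S.reqCoin B a = freshCoin B a >>= fun e => RSABlind.transcript B.rsa >>= fun z =>
      pure (e, z) := by
  simp only [reqCoin, freshCoin, bind_assoc, pure_bind, RSABlind.transcript,
    RSABlind.unblind_sign_blind]
  refine bind_congr fun k₁ => bind_congr fun k₂ => bind_congr fun r₁ => bind_congr fun r₂ =>
    bind_congr fun rQ => ?_
  -- With the commitments fixed, the blinding factor occurs only through the blinded message, which
  -- becomes the new uniform variable.
  exact uniform_bind_bijective (S.bsgn.blind_bijective B.rsa (S.hashCoin (S.grp.comm ![k₁] r₁)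
    (S.grp.comm ![k₂] r₂) (S.grp.comm ![a.sk] rQ))) fun u : (ZMod B.rsa.N)ˣ =>
      (pure (_, ((u : ZMod B.rsa.N).val, RSABlind.sign B.rsa (u : ZMod B.rsa.N).val)) : PMF _)

/-! ## Vouchers with simulated proofs -/

/-- The private keys of the ATMs carry valid signatures of the bank. -/
def Certified (k : S.Keys E) : Prop :=
  ∀ j, S.zsgn.valid k.bank.zATM.1 ![(k.atm j).sk] (k.atm j).certRand (k.atm j).cert

/-- A prover that does not use the witness. -/
def WitnessFree {σ : Type} (V : S.Svc σ)
    (go : Stmt p G S.zsgn.PK → StateT σ PMF S.Proof) : Prop :=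
  ∀ x w, Rel S.grp S.zsgn x w → V.prove x w = go x >>= fun π => pure (some π)

theorem witnessFree_simulated : WitnessFree S.nizk.simulated S.nizk.simGo :=
  fun _ _ h => if_pos h

/-- A coin and a voucher with uniformly random commitments and tokens. -/
def randomVoucher {σ : Type} (go : Stmt p G S.zsgn.PK → StateT σ PMF S.Proof) (B : S.Bank)
    (P : G) (π : S.Proof) : StateT σ PMF (Coin G × Voucher p G S.Proof) := do
  let X ← (PMF.uniformOfFintype G : PMF G)
  let Y ← (PMF.uniformOfFintype G : PMF G)
  let K₁ ← (PMF.uniformOfFintype G : PMF G)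
  let K₂ ← (PMF.uniformOfFintype G : PMF G)
  let Q ← (PMF.uniformOfFintype G : PMF G)
  let πA ← go (.cert B.zATM.1 Q)
  let πC ← go (.coin K₁ K₂ X Y Q (S.hashCom P + 1) (S.hashCom P))
  pure (signedCoin B K₁ K₂ Q, ⟨P, π, X, Y, πC, πA, S.hashCom P⟩)

/-- With a witness-free prover, issuing a fresh coin always succeeds, and what is issued does not
depend on the ATM. -/
theorem freshCoin_bind_issueVoucher {σ γ : Type} {V : S.Svc σ}
    {go : Stmt p G S.zsgn.PK → StateT σ PMF S.Proof} (hV : WitnessFree V go) {k : S.Keys E}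
    (hk : Certified k) (j : Fin E.numATM) (P : G) (hP : S.hashCom P ≠ 0) (π : S.Proof)
    (H : StoredCoin p G → Option (Coin G × Voucher p G S.Proof) → StateT σ PMF γ)
    (F : Coin G × Voucher p G S.Proof → StateT σ PMF γ) (hHF : ∀ e z, H e (some z) = F z) :
    ((liftM (freshCoin k.bank (k.atm j)) : StateT σ PMF _) >>= fun e =>
      issueVoucher V k j e P π >>= H e) = randomVoucher go k.bank P π >>= F := by
  simp only [freshCoin, lift_bind, lift_pure, bind_assoc, pure_bind, unifZ]
  -- Keys and openings matter only through the group elements `X`, `Y`, `K₁`, `K₂`, `Q`. The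
  -- certificate and the identity of the ATM have disappeared because the prover ignores witnesses.
  have hissue : ∀ k₁ k₂ r₁ r₂ rQ : ZMod p, (issueVoucher V k j ⟨signedCoin k.bank
      (S.grp.comm ![k₁] r₁) (S.grp.comm ![k₂] r₂) (S.grp.comm ![(k.atm j).sk] rQ),
      k₁, r₁, k₂, r₂, rQ⟩ P π >>= H ⟨signedCoin k.bank
      (S.grp.comm ![k₁] r₁) (S.grp.comm ![k₂] r₂) (S.grp.comm ![(k.atm j).sk] rQ),
      k₁, r₁, k₂, r₂, rQ⟩) =
      (fun X Y K₁ K₂ Q => go (.cert k.bank.zATM.1 Q) >>= fun πA =>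
        go (.coin K₁ K₂ X Y Q (S.hashCom P + 1) (S.hashCom P)) >>= fun πC =>
          F (signedCoin k.bank K₁ K₂ Q, ⟨P, π, X, Y, πC, πA, S.hashCom P⟩))
        (S.grp.prf k₁ (S.hashCom P + 1)) ((k.atm j).pk * gpow (S.grp.prf k₂ 0) (S.hashCom P))
        (S.grp.comm ![k₁] r₁) (S.grp.comm ![k₂] r₂) (S.grp.comm ![(k.atm j).sk] rQ) := by
    intro k₁ k₂ r₁ r₂ rQ
    simp only [issueVoucher, signedCoin]
    rw [hV (.cert _ _) (.cert ![(k.atm j).sk] rQ (k.atm j).certRand (k.atm j).cert)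
        ⟨rfl, hk j⟩,
      hV (.coin _ _ _ ((k.atm j).pk * gpow (S.grp.prf k₂ 0) (S.hashCom P)) _ _ _)
        (.coin k₁ r₁ k₂ r₂ (k.atm j).sk rQ) ⟨rfl, rfl, rfl, rfl, rfl⟩]
    simp only [bind_assoc, pure_bind, hHF]
  simp only [hissue]
  clear hissue
  simp only [randomVoucher, bind_assoc, pure_bind]
  have hY : Function.Bijective fun k₂ =>
      (k.atm j).pk * gpow (S.grp.prf k₂ 0) (S.hashCom P) :=
    (Group.mulLeft_bijective _).comp
      ((S.grp.gpow_left_bijective hP).comp (S.grp.prf_bijective 0))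
  have hX := S.grp.prf_bijective (S.hashCom P + 1)
  -- Five changes of variables. `X` and `Y` come before the commitments, whose bijections in `r₁`
  -- and `r₂` are taken with `k₁` and `k₂` fixed.
  rw [← lift_uniform_bind_bijective hX]
  refine bind_congr fun k₁ => ?_
  rw [← lift_uniform_bind_bijective hY]
  refine bind_congr fun k₂ => ?_
  rw [← lift_uniform_bind_bijective (S.grp.comm_bijective ![k₁])]
  refine bind_congr fun r₁ => ?_
  rw [← lift_uniform_bind_bijective (S.grp.comm_bijective ![k₂])]
  refine bind_congr fun r₂ => ?_
  rw [← lift_uniform_bind_bijective (S.grp.comm_bijective ![(k.atm j).sk])]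

/-! ## Key stores of fresh coins -/

/-- Key stores that contain `c j` fresh coins of ATM `j`. -/
def stores (k : S.Keys E) (c : Fin E.numATM → ℕ) : PMF (Fin E.numATM → List (StoredCoin p G)) :=
  sampleFamily fun j => sampleList (freshCoin k.bank (k.atm j)) (c j)

theorem stores_update (k : S.Keys E) (c : Fin E.numATM → ℕ) (j : Fin E.numATM) (m : ℕ)
    (T : List (StoredCoin p G) → PMF (List (StoredCoin p G)))
    (hT : sampleList (freshCoin k.bank (k.atm j)) m =
      sampleList (freshCoin k.bank (k.atm j)) (c j) >>= T) :
    stores k (Function.update c j m) =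
      stores k c >>= fun st => T (st j) >>= fun l => pure (Function.update st j l) := by
  rw [stores, stores, ← sampleFamily_update]
  congr 1
  funext i
  by_cases hi : i = j
  · subst hi; simpa using hT
  · simp [hi]

theorem lift_stores_append {σ γ : Type} (k : S.Keys E) (c : Fin E.numATM → ℕ) (j : Fin E.numATM)
    (n : ℕ) (K : (Fin E.numATM → List (StoredCoin p G)) → StateT σ PMF γ) :
    ((liftM (stores k c) : StateT σ PMF _) >>= fun st =>
      (liftM (sampleList (freshCoin k.bank (k.atm j)) n) : StateT σ PMF _) >>= fun l =>
        K (Function.update st j (st j ++ l))) =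
      liftM (stores k (Function.update c j (c j + n))) >>= K := by
  rw [stores_update k c j (c j + n) (fun l => sampleList (freshCoin k.bank (k.atm j)) n >>=
    fun l' => pure (l ++ l')) (sampleList_add _ _ _)]
  simp only [lift_bind, lift_pure, bind_assoc, pure_bind]

/-- Deferred sampling: the head of a store may be drawn separately from the remaining `m` coins,
hence only when it is taken. -/
theorem lift_stores_cons {σ γ : Type} (k : S.Keys E) {c : Fin E.numATM → ℕ} {j : Fin E.numATM}
    {m : ℕ} (hm : c j = m + 1)
    (K : (Fin E.numATM → List (StoredCoin p G)) → StateT σ PMF γ) :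
    ((liftM (stores k c) : StateT σ PMF _) >>= K) =
      (liftM (freshCoin k.bank (k.atm j)) : StateT σ PMF _) >>= fun e =>
        (liftM (stores k (Function.update c j m)) : StateT σ PMF _) >>= fun st =>
          K (Function.update st j (e :: st j)) := by
  -- Regarded as a step from length `m` up to `m + 1`, the change has the form of `stores_update`.
  have h : c = Function.update (Function.update c j m) j (m + 1) := by
    rw [Function.update_idem, ← hm, Function.update_eq_self]
  conv_lhs => rw [h]
  rw [stores_update k (Function.update c j m) j (m + 1) (fun l => freshCoin k.bank (k.atm j) >>=
    fun e => pure (e :: l)) (by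
      rw [Function.update_self, sampleList]; exact pmf_bind_comm _ _ _)]
  simp only [lift_bind, lift_pure, bind_assoc, pure_bind]
  exact (lift_bind_comm _ _ _).symm

/-! ## Continuations that do not see the key stores -/

/-- The continuations `K` and `K'` give the same result, whatever numbers of fresh coins are in the
key stores, as long as every honest ATM has at least `r` of them. -/
def StoreIndist {σ γ : Type} (k : S.Keys E) (r : ℕ) (K K' : S.Sys E → StateT σ PMF γ) : Prop :=
  ∀ (d : S.Dyn E) (ab : Bool) (c c' : Fin E.numATM → ℕ),
    (∀ j : Fin E.numATM, j.val < E.honestATM → r ≤ c j) →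
    (∀ j : Fin E.numATM, j.val < E.honestATM → r ≤ c' j) →
    ((liftM (stores k c) : StateT σ PMF _) >>= fun st => K ⟨k, st, d, ab⟩) =
      liftM (stores k c') >>= fun st => K' ⟨k, st, d, ab⟩

section

variable {σ γ : Type} {k : S.Keys E} {r : ℕ} (V : S.Svc σ)

theorem le_update_of_le {c : Fin E.numATM → ℕ} (j : Fin E.numATM) {m : ℕ}
    (hc : ∀ j : Fin E.numATM, j.val < E.honestATM → r + 1 ≤ c j) (hm : r ≤ m) :
    ∀ j' : Fin E.numATM, j'.val < E.honestATM → r ≤ Function.update c j m j' := by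
  intro j' hj'
  by_cases h : j' = j
  · subst h; simpa using hm
  · simpa [h] using (Nat.le_succ r).trans (hc j' hj')

theorem run_answer_dyn {x : S.Query E} (hx : ∀ j n, x ≠ .atmReqCoin j n)
    (hx' : ∀ j i P π, x ≠ .atmIssue j i P π) (y : S.Sys E) :
    (answer V x).run y = (answerDyn V y.keys x).run y.dyn >>= fun z =>
      pure (z.1, { y with dyn := z.2 }) := by
  cases x
  case atmReqCoin j n => exact absurd rfl (hx j n)
  case atmIssue j i P π => exact absurd rfl (hx' j i P π)
  all_goals
    simp only [answer, StateT.run_bind, StateT.run_get, pure_bind, liftM, StateT.run_monadLift,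
      bind_assoc, StateT.run_set, StateT.run_pure, monadLift_self]

/-- These queries neither read nor write the stores, so the sampling of the stores moves past them.
-/
theorem storeIndist_answer_dyn {x : S.Query E} (hx : ∀ j n, x ≠ .atmReqCoin j n)
    (hx' : ∀ j i P π, x ≠ .atmIssue j i P π) {K K' : S.Reply × S.Sys E → StateT σ PMF γ}
    (h : ∀ z, StoreIndist k r (fun y => K (z, y)) fun y => K' (z, y)) :
    StoreIndist k (r + 1) (fun y => (answer V x).run y >>= K)
      fun y => (answer V x).run y >>= K' := by
  intro d ab c c' hc hc'
  simp only [run_answer_dyn V hx hx', bind_assoc, pure_bind]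
  rw [lift_bind_comm, lift_bind_comm]
  exact bind_congr fun z => h _ _ _ _ _ (fun j hj => (Nat.le_succ r).trans (hc j hj))
    fun j hj => (Nat.le_succ r).trans (hc' j hj)

/-- By blindness the transcripts shown to the adversary are independent of the new coins, which only
lengthen a store. -/
theorem storeIndist_answer_atmReqCoin (j : Fin E.numATM) (n : ℕ)
    {K K' : S.Reply × S.Sys E → StateT σ PMF γ}
    (h : ∀ z, StoreIndist k r (fun y => K (z, y)) fun y => K' (z, y)) :
    StoreIndist k (r + 1) (fun y => (answer V (.atmReqCoin j n)).run y >>= K)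
      fun y => (answer V (.atmReqCoin j n)).run y >>= K' := by
  intro d ab c c' hc hc'
  have hle : ∀ {c : Fin E.numATM → ℕ},
      (∀ j : Fin E.numATM, j.val < E.honestATM → r + 1 ≤ c j) →
      ∀ j : Fin E.numATM, j.val < E.honestATM → r ≤ c j :=
    fun hc j hj => (Nat.le_succ r).trans (hc j hj)
  by_cases hj : j.val < E.honestATM ∧ n ≤ E.batch
  · have key : ∀ (c : Fin E.numATM → ℕ) (K : S.Reply × S.Sys E → StateT σ PMF γ),
        ((liftM (stores k c) : StateT σ PMF _) >>= fun st =>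
          (answer V (.atmReqCoin j n)).run ⟨k, st, d, ab⟩ >>= K) =
        (liftM (sampleList (RSABlind.transcript k.bank.rsa) n) : StateT σ PMF _) >>= fun l =>
          (liftM (stores k (Function.update c j (c j + n))) : StateT σ PMF _) >>= fun st =>
            K (.transcript l, ⟨k, st, d, ab⟩) := by
      intro c K
      have h₁ : ∀ st : Fin E.numATM → List (StoredCoin p G),
          ((answer V (.atmReqCoin j n)).run (⟨k, st, d, ab⟩ : S.Sys E) >>= K) =
          (liftM (sampleList (freshCoin k.bank (k.atm j)) n) : StateT σ PMF _) >>= fun l =>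
            (liftM (sampleList (RSABlind.transcript k.bank.rsa) n) : StateT σ PMF _) >>= fun l' =>
              K (.transcript l', ⟨k, Function.update st j (st j ++ l), d, ab⟩) := by
        intro st
        simp only [answer, if_pos hj, StateT.run_bind, StateT.run_get, pure_bind, liftM,
          StateT.run_monadLift, bind_assoc, StateT.run_set, StateT.run_pure,
          funext fun a => reqCoin_eq k.bank a]
        exact lift_sampleList_prod _ _ _ fun l l' =>
          K (.transcript l', ⟨k, Function.update st j (st j ++ l), d, ab⟩)
      simp only [h₁]
      conv_rhs => rw [lift_bind_comm]
      exact lift_stores_append k c j n fun st =>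
        (liftM (sampleList (RSABlind.transcript k.bank.rsa) n) : StateT σ PMF _) >>= fun l' =>
          K (.transcript l', ⟨k, st, d, ab⟩)
    rw [key, key]
    exact bind_congr fun l => h _ _ _ _ _
      (le_update_of_le j hc (by have := hle hc j hj.1; omega))
      (le_update_of_le j hc' (by have := hle hc' j hj.1; omega))
  · simp only [answer, if_neg hj, StateT.run_pure, pure_bind]
    exact h _ _ _ _ _ (hle hc) (hle hc')

theorem StoreIndist.mono {r' : ℕ} {K K' : S.Sys E → StateT σ PMF γ} (h : StoreIndist k r K K')
    (hr : r ≤ r') : StoreIndist k r' K K' :=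
  fun _ _ _ _ hc hc' => h _ _ _ _ (fun j hj => hr.trans (hc j hj))
    fun j hj => hr.trans (hc' j hj)

/-- A length of at least `r + 1` rules out an empty store. The coin that is taken is then a fresh
one of ATM `j` on both sides, whatever the lengths, and at least `r` coins remain. -/
theorem storeIndist_answer_atmIssue (j : Fin E.numATM) (i : Fin E.numUser) (P : G) (π : S.Proof)
    {K K' : S.Reply × S.Sys E → StateT σ PMF γ}
    (h : ∀ z, StoreIndist k r (fun y => K (z, y)) fun y => K' (z, y)) :
    StoreIndist k (r + 1) (fun y => (answer V (.atmIssue j i P π)).run y >>= K)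
      fun y => (answer V (.atmIssue j i P π)).run y >>= K' := by
  intro d ab c c' hc hc'
  by_cases hj : j.val < E.honestATM
  · have key : ∀ (c : Fin E.numATM → ℕ) (m : ℕ), c j = m + 1 →
        ∀ K : S.Reply × S.Sys E → StateT σ PMF γ,
        ((liftM (stores k c) : StateT σ PMF _) >>= fun st =>
          (answer V (.atmIssue j i P π)).run ⟨k, st, d, ab⟩ >>= K) =
        verifyProof V (.cert k.bank.zUser.1 P) π >>= fun ok =>
          if (ok && decide (1 ≤ d.balance i)) = true then
            (liftM (freshCoin k.bank (k.atm j)) : StateT σ PMF _) >>= fun e =>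
              issueVoucher V k j e P π >>= fun z =>
                match z with
                | none => (liftM (stores k (Function.update c j m)) : StateT σ PMF _) >>=
                    fun st => K (.abort, ⟨k, st, d, ab⟩)
                | some (C, W) => (makePromise k j i C W).run d >>= fun x =>
                    (liftM (stores k (Function.update c j m)) : StateT σ PMF _) >>=
                      fun st => K (.promise x.1, ⟨k, st, x.2, ab⟩)
          else (liftM (stores k c) : StateT σ PMF _) >>= fun st => K (.abort, ⟨k, st, d, ab⟩) := by
      intro c m hm K
      simp only [answer, if_pos hj, StateT.run_bind, StateT.run_get, pure_bind, liftM,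
          StateT.run_monadLift, bind_assoc, monadLift_self]
      rw [lift_bind_comm]
      refine bind_congr fun ok => ?_
      split_ifs with hok
      · rw [lift_stores_cons k hm]
        refine bind_congr fun e => ?_
        simp only [hok, Function.update_self, StateT.run_bind, pure_bind, liftM,
          StateT.run_monadLift, bind_assoc, monadLift_self, Function.update_idem,
          Function.update_eq_self]
        rw [lift_bind_comm]
        refine bind_congr fun z => ?_
        rcases z with _ | ⟨C, W⟩
        · simp
        · simp only [StateT.run_bind, pure_bind, liftM, StateT.run_monadLift, bind_assoc,
            monadLift_self, StateT.run_set, StateT.run_pure]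
          rw [lift_bind_comm]
      · simp [Bool.eq_false_iff.2 hok]
    obtain ⟨m, hm⟩ := Nat.exists_eq_succ_of_ne_zero (Nat.ne_zero_of_lt (hc j hj))
    obtain ⟨m', hm'⟩ := Nat.exists_eq_succ_of_ne_zero (Nat.ne_zero_of_lt (hc' j hj))
    rw [key c m hm, key c' m' hm']
    have hu := le_update_of_le j hc (m := m) (by have := hc j hj; omega)
    have hu' := le_update_of_le j hc' (m := m') (by have := hc' j hj; omega)
    refine bind_congr fun ok => ?_
    split_ifs with hok
    · refine bind_congr fun e => bind_congr fun z => ?_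
      rcases z with _ | ⟨C, W⟩
      · exact h _ _ _ _ _ hu hu'
      · exact bind_congr fun x => h _ _ _ _ _ hu hu'
    · exact (h _).mono (Nat.le_succ r) _ _ _ _ hc hc'
  · simp only [answer, if_neg hj, StateT.run_pure, pure_bind]
    exact (h _).mono (Nat.le_succ r) _ _ _ _ hc hc'

theorem storeIndist_answer (x : S.Query E) {K K' : S.Reply × S.Sys E → StateT σ PMF γ}
    (h : ∀ z, StoreIndist k r (fun y => K (z, y)) fun y => K' (z, y)) :
    StoreIndist k (r + 1) (fun y => (answer V x).run y >>= K)
      fun y => (answer V x).run y >>= K' := by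
  cases x
  case atmReqCoin j n => exact storeIndist_answer_atmReqCoin V j n h
  case atmIssue j i P π => exact storeIndist_answer_atmIssue V j i P π h
  all_goals exact storeIndist_answer_dyn V (by simp) (by simp) h

/-- Each oracle query of an algorithm needs at most one coin per ATM. -/
theorem storeIndist_eval {α β : Type} (P : Prog (S.Query E) S.Reply α β) (a : α)
    {K K' : β × S.Sys E → StateT σ PMF γ}
    (h : ∀ b, StoreIndist k r (fun y => K (b, y)) fun y => K' (b, y)) :
    StoreIndist k (r + P.calls) (fun y => (P.eval (answer V) a).run y >>= K)
      fun y => (P.eval (answer V) a).run y >>= K' := by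
  induction P generalizing r with
  | step f =>
      intro d ab c c' hc hc'
      simp only [Prog.eval, liftM, StateT.run_monadLift, bind_assoc, pure_bind]
      conv_lhs => rw [lift_bind_comm]
      conv_rhs => rw [lift_bind_comm]
      exact bind_congr fun b => h b _ _ _ _ hc hc'
  | call =>
      cases a with
      | none =>
          simp only [Prog.eval, StateT.run_pure, pure_bind]
          exact (h none).mono (Nat.le_add_right _ _)
      | some x =>
          simp only [Prog.eval, StateT.run_bind, StateT.run_pure, bind_assoc, pure_bind]
          exact storeIndist_answer V x fun z => h (some z)
  | seq P P' ih ih' =>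
      simp only [Prog.eval, Prog.calls, StateT.run_bind, bind_assoc]
      -- Coins are counted backwards: after `P` there must still be `r + P'.calls` of them.
      rw [add_comm P.calls, ← add_assoc]
      exact ih a fun b => ih' b h
  | frame γ P ih =>
      obtain ⟨a, z⟩ := a
      simp only [Prog.eval, Prog.calls, StateT.run_bind, StateT.run_pure, bind_assoc, pure_bind]
      exact ih a fun b => h (b, z)
  | swap α β γ =>
      obtain ⟨⟨a, b⟩, z⟩ := a
      simp only [Prog.eval, StateT.run_pure, pure_bind]
      exact h _

/-- With a witness-free prover, the challenge is the same for both ATMs, and it takes one coin. -/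
theorem storeIndist_challenge {go : Stmt p G S.zsgn.PK → StateT σ PMF S.Proof}
    (hV : WitnessFree V go) (hk : Certified k) (hH : ∀ P : G, S.hashCom P ≠ 0) (ch : Choice E)
    (b b' : Bool) {K K' : Option (Coin G × Voucher p G S.Proof) × S.Sys E → StateT σ PMF γ}
    (h : ∀ o, StoreIndist k r (fun y => K (o, y)) fun y => K' (o, y)) :
    StoreIndist k (r + 1) (fun y => challenge V b (ch, y) >>= K)
      fun y => challenge V b' (ch, y) >>= K' := by
  intro d ab c c' hc hc'
  obtain ⟨⟨j₀, j₁⟩, i⟩ := ch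
  by_cases hadm : j₀.val < E.honestATM ∧ j₁.val < E.honestATM ∧ j₀ ≠ j₁ ∧ i.val < E.honestUser
  · have key : ∀ (b : Bool) (j : Fin E.numATM), (if b then j₁ else j₀) = j →
        ∀ (c : Fin E.numATM → ℕ) (m : ℕ), c j = m + 1 →
        ∀ K : Option (Coin G × Voucher p G S.Proof) × S.Sys E → StateT σ PMF γ,
        ((liftM (stores k c) : StateT σ PMF _) >>= fun st =>
          challenge V b (((j₀, j₁), i), ⟨k, st, d, ab⟩) >>= K) =
        withdrawRequest V k i >>= fun x =>
          match x.2.2 with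
          | none => (liftM (stores k c) : StateT σ PMF _) >>= fun st => K (none, ⟨k, st, d, true⟩)
          | some π => verifyProof V (.cert k.bank.zUser.1 x.2.1) π >>= fun ok =>
              if (ok && decide (1 ≤ d.balance i)) = true then
                randomVoucher go k.bank x.2.1 π >>= fun z =>
                  (liftM (stores k (Function.update c j m)) : StateT σ PMF _) >>=
                    fun st => K (some z, ⟨k, st, { d with
                      wallet := Function.update d.wallet i (d.wallet i ++ [(z.1, z.2, x.1)]) }, ab⟩)
              else (liftM (stores k c) : StateT σ PMF _) >>= fun st =>
                K (none, ⟨k, st, d, true⟩) := by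
      intro b j hj c m hm K
      simp only [challenge, if_pos hadm, bind_assoc, hj]
      rw [lift_bind_comm]
      refine bind_congr fun x => ?_
      obtain ⟨rd, P, _ | π⟩ := x
      · simp only [pure_bind]
      · simp only [bind_assoc]
        rw [lift_bind_comm]
        refine bind_congr fun ok => ?_
        by_cases hok : (ok && decide (1 ≤ d.balance i)) = true
        · rw [if_pos hok, lift_stores_cons k hm]
          -- After a success the coin `e` has left the store and its secrets are gone, so the
          -- continuation does not depend on `e`. The `none` branch, which would keep `e`, never
          -- occurs.
          refine Eq.trans ?_ (freshCoin_bind_issueVoucher hV hk j P (hH P) π (fun e z => match z with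
              | none => (liftM (stores k (Function.update c j m)) : StateT σ PMF _) >>= fun st =>
                  K (none, ⟨k, Function.update st j (e :: st j), d, true⟩)
              | some z => (liftM (stores k (Function.update c j m)) : StateT σ PMF _) >>= fun st =>
                  K (some z, ⟨k, st, { d with
                    wallet := Function.update d.wallet i (d.wallet i ++ [(z.1, z.2, rd)]) }, ab⟩))
              _ fun e z => rfl)
          refine bind_congr fun e => ?_
          simp only [hok, Function.update_self, bind_assoc, Function.update_idem,
            Function.update_eq_self]
          rw [lift_bind_comm]
          refine bind_congr fun z => ?_
          rcases z with _ | ⟨C, W⟩ <;> simp only [pure_bind]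
        · rw [if_neg hok]
          simp only [Bool.eq_false_iff.2 hok, pure_bind]
    have hpos : ∀ (b : Bool) {c : Fin E.numATM → ℕ},
        (∀ j : Fin E.numATM, j.val < E.honestATM → r + 1 ≤ c j) →
        ∃ (j : Fin E.numATM) (m : ℕ), (if b then j₁ else j₀) = j ∧ c j = m + 1 ∧ r ≤ m := by
      intro b c hc
      have hj : (if b then j₁ else j₀).val < E.honestATM := by
        cases b
        · exact hadm.1
        · exact hadm.2.1
      have := hc _ hj
      exact ⟨_, c (if b then j₁ else j₀) - 1, rfl, by omega, by omega⟩
    obtain ⟨j, m, hj, hm, hr⟩ := hpos b hc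
    obtain ⟨j', m', hj', hm', hr'⟩ := hpos b' hc'
    rw [key b j hj c m hm, key b' j' hj' c' m' hm']
    refine bind_congr fun x => ?_
    obtain ⟨rd, P, _ | π⟩ := x
    · exact (h _).mono (Nat.le_succ r) _ _ _ _ hc hc'
    · refine bind_congr fun ok => ?_
      split_ifs with hok
      -- The two sides now differ only in which store was shortened, and `StoreIndist` allows
      -- unrelated length vectors.
      · exact bind_congr fun z => h _ _ _ _ _ (le_update_of_le _ hc hr) (le_update_of_le _ hc' hr')
      · exact (h _).mono (Nat.le_succ r) _ _ _ _ hc hc'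
  · simp only [challenge, if_neg hadm, pure_bind]
    exact (h _).mono (Nat.le_succ r) _ _ _ _ hc hc'

end

/-! ## The initialization -/

variable (S E) in
/-- The generation of all keys. -/
def initKeys : PMF (S.Keys E) := do
  let B ← S.initBank
  let atm ← sampleFin (S.initATM B) E.numATM
  let user ← sampleFin (S.initUser B) E.numUser
  pure ⟨B, atm, user⟩

variable (E) in
/-- The number of coins that an ATM withdraws at the start. -/
def initialCount (j : Fin E.numATM) : ℕ := if j.val < E.honestATM then E.stock else 0

/-- The input of the adversary, for given keys and transcripts. -/
def publicData (k : S.Keys E) (tr : Fin E.numATM → List (ℕ × ℕ)) : S.Public E where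
  rsaN := k.bank.rsa.N
  rsaE := k.bank.rsa.e
  zUser := k.bank.zUser.1
  zATM := k.bank.zATM.1
  vkBank := k.bank.sig.1
  atm := fun j => ((k.atm j).pk, (k.atm j).vk)
  user := fun i => ((k.user i).pk, (k.user i).vk)
  atmSecret := fun j => if j.val < E.honestATM then none else some (k.atm j)
  userSecret := fun i => if i.val < E.honestUser then none else some (k.user i)
  transcripts := tr

variable (S E) in
/-- The mutable state at the start. -/
def initialDyn : S.Dyn E where
  ro := fun _ => none
  atmSession := fun _ => []
  userSession := fun _ => []
  wallet := fun _ => []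
  merchant := fun _ => []
  balance := E.balance
  settled := []
  log := []
  invalid := []

/-- Correctness of `zsgn`, applied to the commitment to `sk` that the bank signed for the ATM.
Without valid certificates an abort could reveal the ATM. -/
theorem certified_of_mem_support {k : S.Keys E} (hk : k ∈ (initKeys S E).support) :
    Certified k := by
  obtain ⟨B, hB, hk⟩ := (PMF.mem_support_bind_iff _ _ _).1 hk
  obtain ⟨atm, hatm, hk⟩ := (PMF.mem_support_bind_iff _ _ _).1 hk
  obtain ⟨user, -, hk⟩ := (PMF.mem_support_bind_iff _ _ _).1 hk
  obtain rfl := (PMF.mem_support_pure_iff _ _).1 hk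
  obtain ⟨sig, -, hB⟩ := (PMF.mem_support_bind_iff _ _ _).1 hB
  obtain ⟨rsa, -, hB⟩ := (PMF.mem_support_bind_iff _ _ _).1 hB
  obtain ⟨zU, -, hB⟩ := (PMF.mem_support_bind_iff _ _ _).1 hB
  obtain ⟨zA, hzA, hB⟩ := (PMF.mem_support_bind_iff _ _ _).1 hB
  obtain rfl := (PMF.mem_support_pure_iff _ _).1 hB
  intro j
  have h := mem_support_sampleFin hatm j
  obtain ⟨sk, -, h⟩ := (PMF.mem_support_bind_iff _ _ _).1 h
  obtain ⟨r, -, h⟩ := (PMF.mem_support_bind_iff _ _ _).1 h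
  obtain ⟨s, hs, h⟩ := (PMF.mem_support_bind_iff _ _ _).1 h
  obtain ⟨z, -, h⟩ := (PMF.mem_support_bind_iff _ _ _).1 h
  have h := (PMF.mem_support_pure_iff _ _).1 h
  change S.zsgn.valid zA.1 ![(atm j).sk] (atm j).certRand (atm j).cert
  rw [h]
  exact S.zsgn.correct zA hzA 1 ![sk] r s hs

theorem initialStock_eq (B : S.Bank) (atm : Fin E.numATM → S.ATM) (n : ℕ) (hn : n ≤ E.numATM) :
    initialStock B atm n hn = sampleFamily fun i : Fin n =>
      sampleList (S.reqCoin B (atm (i.castLE hn))) (initialCount E (i.castLE hn)) := by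
  induction n with
  | zero => rfl
  | succ n ih =>
      rw [initialStock, ih]
      rfl

/-- The key stores at the start are independent of the transcripts. -/
theorem lift_setup_bind {σ γ : Type} (K : S.Public E × S.Sys E → StateT σ PMF γ) :
    ((liftM (S.setup E) : StateT σ PMF _) >>= K) =
      (liftM (initKeys S E) : StateT σ PMF _) >>= fun k =>
        (liftM (sampleFamily fun j => sampleList (RSABlind.transcript k.bank.rsa)
          (initialCount E j)) : StateT σ PMF _) >>= fun tr =>
            (liftM (stores k (initialCount E)) : StateT σ PMF _) >>= fun st =>
              K (publicData k tr, ⟨k, st, initialDyn S E, false⟩) := by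
  simp only [setup, initKeys, lift_bind, lift_pure, bind_assoc, pure_bind]
  refine bind_congr fun B => bind_congr fun atm => bind_congr fun user => ?_
  rw [lift_bind_comm, initialStock_eq, stores]
  refine (lift_bind_map _ (fun st : Fin E.numATM → List (StoredCoin p G × (ℕ × ℕ)) =>
      ((fun j => (st j).map Prod.fst), fun j => (st j).map Prod.snd))
      fun z => K (publicData ⟨B, atm, user⟩ z.2,
        ⟨⟨B, atm, user⟩, z.1, initialDyn S E, false⟩)).trans ?_
  rw [sampleFamily_prod (List.map Prod.fst) (List.map Prod.snd) _
      (fun j => sampleList (freshCoin B (atm j)) (initialCount E j))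
      (fun j => sampleList (RSABlind.transcript B.rsa) (initialCount E j))
      (fun j k => by rw [reqCoin_eq]; exact sampleList_prod _ _ _ k) fun f f' => pure (f, f')]
  simp only [lift_bind, lift_pure, bind_assoc, pure_bind]

/-- With a witness-free prover, the two experiments are the same, as long as the adversary cannot
exhaust a key store. -/
theorem experiment_eq_of_witnessFree {σ : Type} {V : S.Svc σ}
    {go : Stmt p G S.zsgn.PK → StateT σ PMF S.Proof} (hV : WitnessFree V go)
    (hH : ∀ P : G, S.hashCom P ≠ 0) (A : S.Adversary E) (hA : A.calls < E.stock) :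
    experiment V false A = experiment V true A := by
  simp only [experiment]
  rw [lift_setup_bind, lift_setup_bind]
  refine lift_bind_congr _ fun k hk => bind_congr fun tr => ?_
  have hk := certified_of_mem_support hk
  -- Start of the backward argument: the verdict does not look at the stores, so `r = 0` suffices.
  have hverdict : ∀ g : Bool, StoreIndist (S := S) (E := E) (σ := σ) k 0
      (fun y => pure (verdict (g, y))) fun y => pure (verdict (g, y)) := by
    intro g d ab c c' _ _
    simp only [verdict, lift_bind_const]
  let guess := fun (mem : A.Mem) (z : Option (Coin G × Voucher p G S.Proof) × S.Sys E) =>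
    (A.second.eval (answer V) (z.1, mem)).run z.2 >>= fun x => pure (verdict x)
  have hsecond : ∀ mem o, StoreIndist k (0 + A.second.calls) (fun y => guess mem (o, y))
      fun y => guess mem (o, y) := fun mem o =>
    storeIndist_eval V A.second (o, mem) (K := fun z => pure (verdict z))
      (K' := fun z => pure (verdict z)) hverdict
  let proceed := fun (b : Bool) (z : (Choice E × A.Mem) × S.Sys E) =>
    challenge V b (z.1.1, z.2) >>= guess z.1.2
  have hchallenge : ∀ x, StoreIndist k (0 + A.second.calls + 1)
      (fun y => proceed false (x, y)) fun y => proceed true (x, y) := fun x =>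
    storeIndist_challenge V hV hk hH x.1 false true (hsecond x.2)
  have hfirst := storeIndist_eval V A.first (publicData k tr) hchallenge
  -- One coin per query of either phase and one for the challenge; this makes the strict inequality
  -- `A.calls < E.stock` just enough.
  have hcount : ∀ j : Fin E.numATM, j.val < E.honestATM →
      0 + A.second.calls + 1 + A.first.calls ≤ initialCount E j := by
    intro j hj
    rw [initialCount, if_pos hj]
    rw [Adversary.calls] at hA
    omega
  exact hfirst (initialDyn S E) false _ _ hcount hcount

theorem simProb_eq (hH : ∀ P : G, S.hashCom P ≠ 0) (A : S.Adversary E) (hA : A.calls < E.stock) :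
    simProb false A = simProb true A := by
  rw [simProb, simProb, experiment_eq_of_witnessFree witnessFree_simulated hH A hA]

end Scheme

end ECash

end

/-- The commitments are perfectly hiding, the blinding is perfect, and every PRF key of a coin is used
for a single evaluation, which is then uniformly distributed. Only the simulation of the proofs
contributes: the bound holds already with `2 * zkAdv`, and the other advantages are nonnegative. -/
theorem mainTheorem1 {p : ℕ} [Fact p.Prime] {G : Type} [CommGroup G] [Fintype G] {lam : ℕ}
    (S : ECash.Scheme p G lam) (hH : ∀ P : G, S.hashCom P ≠ 0)
    (E : ECash.Setting) (c : ECash.CostModel) (t τ : ℕ∞) (q n : ℕ)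
    (hstock : q < E.stock) (hcost : S.HonestCost E c τ n) :
    S.untraceAdv E c t q ≤
      6 * S.grp.hidingAdv c t q + 4 * S.grp.prfAdv c t q +
        4 * S.nizk.zkAdv c (t + (q + 3) * τ) ((q + 3) * n) +
        2 * S.bsgn.blindAdv c t q := by
  have hhiding : 0 ≤ S.grp.hidingAdv c t q := Real.iSup_nonneg fun _ => abs_nonneg _
  have hprf : 0 ≤ S.grp.prfAdv c t q := Real.iSup_nonneg fun _ => abs_nonneg _
  have hblind : 0 ≤ S.bsgn.blindAdv c t q := Real.iSup_nonneg fun _ => abs_nonneg _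
  have hzk : 0 ≤ S.nizk.zkAdv c (t + (q + 3) * τ) ((q + 3) * n) :=
    Real.iSup_nonneg fun _ => abs_nonneg _
  -- The bound must also be nonnegative, since the supremum is `0` if no adversary meets the limits.
  refine Real.iSup_le ?_ (by positivity)
  rintro ⟨A, ht, hq⟩
  have h₀ := abs_le.1 (ECash.Scheme.abs_simProb_sub_winProb_le hcost A ht hq false)
  have h₁ := abs_le.1 (ECash.Scheme.abs_simProb_sub_winProb_le hcost A ht hq true)
  have h := ECash.Scheme.simProb_eq hH A (hq.trans_lt hstock)
  dsimp only
  linarith [h₀.1, h₀.2, h₁.1, h₁.2]
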